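/- Let $N\ge 1$, let $x_0<x_1<\dots<x_N$ be real points and let $X$ be a quasi-diffusion in natural scale on $E_N=\{x_0,\dots,x_N\}$, reflected at both end points and started at $x_0$: for a speed measure $\sum_i m_i\delta_{x_i}$ with all $m_i>0$, $X$ is the right-continuous Markov jump process on $E_N$ that moves only between neighbouring points and jumps from $x_i$ to a neighbour $x_j$ at rate $1/(m_i|x_j-x_i|)$. Thus the holding times at $x_i$ are exponential, $P(H_i>t)=e^{-a_it}$, with rates $a_i=\sum_{|j-i|=1}1/(m_i|x_j-x_i|)>0$, $i=0,\dots,N$. Assume that from every interior point $x_i$, $0<i<N$, the process jumps to the right and to the left with probability $\tfrac12$ each. (Every choice of rates $a_0,\dots,a_N>0$ occurs.) Let $\tau(s)=\int_0^s 1_{\{X_r=x_0\}}\,dr$ be the local time at $x_0$, let $\tau^{-1}(t)=\inf\{s:\tau(s)>t\}$ be the inverse local time, and let $C(t)$ be the number of jumps from $x_0$ to $x_1$ before the local time at $x_0$ exceeds $t$, i.e. during $[0,\tau^{-1}(t)]$. Then for every $t>0$ one has $\tau^{-1}(t)<\infty$ almost surely, and the law $$S(dy)=P_0\big(\tau^{-1}(t)-t\in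 dy\;\big|\;C(t)=1\big)$$ has, for every $z\ge 0$, the Laplace transform $L(S)(z)=\int e^{-zy}\,S(dy)$ given by the finite continued fraction $$L(S)(z)=\frac{a_1}{2(z+a_1)}\ominus\frac{a_1a_2}{2(z+a_2)}\ominus\cdots\ominus\frac{a_{N-2}a_{N-1}}{2(z+a_{N-1})}\ominus\frac{a_{N-1}a_N}{z+a_N},$$ where $\frac{p}{q}\ominus F$ denotes $\frac{p}{q-F}$, so that the fraction is nested to the right; the factor $2$ is present in every partial denominator except the last, and for $N=1$ the fraction is $\frac{a_1}{z+a_1}$. -/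

import Mathlib

open MeasureTheory ProbabilityTheory Filter Topology
open scoped NNReal ENNReal

noncomputable section

namespace QuasiDiffusion

/-! ### Finite quasi-diffusions

The quasi-diffusion (gap diffusion) in natural scale, reflected at both end points, whose speed
measure is `∑ i, m i • δ_{pt i}`, on the points `pt 0 < pt 1 < ... < pt N`, is the Markov process
with generator `D_m D_x`, that is
`(G f)(pt i) = (1 / m i) * ((f (pt (i+1)) - f (pt i)) / (pt (i+1) - pt i)
                          - (f (pt i) - f (pt (i-1))) / (pt i - pt (i-1)))`,
where at an end point the term that refers to a missing neighbour is left out. -/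

/-- The rate of jumping from the `i`-th to the `j`-th point: the `(i, j)` entry (for `i ≠ j`) of the
generator `D_m D_x`. -/
def transRate {N : ℕ} (pt m : Fin (N + 1) → ℝ) (i j : Fin (N + 1)) : ℝ :=
  if j.val = i.val + 1 ∨ i.val = j.val + 1 then 1 / (m i * |pt j - pt i|) else 0

/-- The rate of the exponential holding time at the `i`-th point. -/
def holdingRate {N : ℕ} (pt m : Fin (N + 1) → ℝ) (i : Fin (N + 1)) : ℝ :=
  ∑ j, transRate pt m i j

/-- The probability that a jump out of the `i`-th point leads to the `j`-th one. -/
def jumpProb {N : ℕ} (pt m : Fin (N + 1) → ℝ) (i j : Fin (N + 1)) : ℝ :=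
  transRate pt m i j / holdingRate pt m i

/-- `X` is, under `P`, a quasi-diffusion with points `pt` and speed masses `m`, started at
`pt start`.  This is the jump chain / holding time description of the Markov process with the
generator above: `Y n` is (the index of) the `n`-th point visited, `T n` is the time spent there
during that visit; given the chain `Y`, the times `T n` are independent and exponential with
rates `holdingRate pt m (Y n)`. -/
def IsQuasiDiffusion {Ω : Type*} [MeasurableSpace Ω] {N : ℕ} (pt m : Fin (N + 1) → ℝ)
    (start : Fin (N + 1)) (P : Measure Ω) (X : ℝ≥0 → Ω → ℝ) : Prop :=
  ∃ (Y : ℕ → Ω → Fin (N + 1)) (T : ℕ → Ω → ℝ≥0),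
    (∀ n, Measurable (Y n)) ∧ (∀ n, Measurable (T n)) ∧
    (∀ (n : ℕ) (i : ℕ → Fin (N + 1)) (t : ℕ → ℝ≥0),
      P.real {ω | ∀ k ≤ n, Y k ω = i k ∧ t k < T k ω} =
        (if i 0 = start then 1 else 0)
          * (∏ k ∈ Finset.range n, jumpProb pt m (i k) (i (k + 1)))
          * ∏ k ∈ Finset.range (n + 1), Real.exp (-(holdingRate pt m (i k) * (t k : ℝ)))) ∧
    ∀ᵐ ω ∂P, ∀ (n : ℕ) (s : ℝ≥0), ∑ k ∈ Finset.range n, T k ω ≤ s →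
      s < ∑ k ∈ Finset.range (n + 1), T k ω → X s ω = pt (Y n ω)

/-! ### Functionals of a path `w : ℝ≥0 → ℝ` -/

/-- The local time at `y` up to time `s`: the time spent at the point `y`. -/
def localTime (w : ℝ≥0 → ℝ) (y : ℝ) (s : ℝ≥0) : ℝ≥0∞ :=
  volume ((fun r : ℝ≥0 => (r : ℝ)) '' {r : ℝ≥0 | r < s ∧ w r = y})

/-- The (right-continuous) inverse local time at `y`; it is `∞` if the local time never
exceeds `t`. -/
def invLocalTime (w : ℝ≥0 → ℝ) (y : ℝ) (t : ℝ≥0) : ℝ≥0∞ :=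
  ⨅ (s : ℝ≥0) (_ : (t : ℝ≥0∞) < localTime w y s), (s : ℝ≥0∞)

/-- The number of jumps from `y` to `y'` before the local time at `y` exceeds `t`. -/
def jumpCount (w : ℝ≥0 → ℝ) (y y' : ℝ) (t : ℝ≥0) : ℕ∞ :=
  Set.encard {s : ℝ≥0 | 0 < s ∧ (s : ℝ≥0∞) ≤ invLocalTime w y t ∧
    (∀ᶠ r in 𝓝[<] s, w r = y) ∧ w s = y'}

/-! ### The law of an excursion and its Laplace transform -/

/-- The law of `τ⁻¹(t) - t` given that there was exactly one jump from `y` to `y'` before the local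
time at `y` exceeds `t`, where `τ⁻¹` is the inverse local time at `y`. -/
def excursionLaw {Ω : Type*} [MeasurableSpace Ω] (P : Measure Ω) (X : ℝ≥0 → Ω → ℝ)
    (y y' : ℝ) (t : ℝ≥0) : Measure ℝ :=
  (ProbabilityTheory.cond P {ω | jumpCount (fun s => X s ω) y y' t = 1}).map
    (fun ω => (invLocalTime (fun s => X s ω) y t).toReal - (t : ℝ))

/-- The Laplace transform of a measure on the line. -/
def laplaceTransform (S : Measure ℝ) (z : ℝ) : ℝ :=
  ∫ y, Real.exp (-(z * y)) ∂S

/-- `minusFrac c d k n` is the finite continued fraction with `n` terms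
`c k / (d k) ⊖ c (k+1) / (d (k+1)) ⊖ ... ⊖ c (k+n-1) / (d (k+n-1))`,
where `p / q ⊖ F` means `p / (q - F)`. -/
def minusFrac (c d : ℕ → ℝ) : ℕ → ℕ → ℝ
  | _, 0 => 0
  | k, n + 1 => c k / (d k - minusFrac c d (k + 1) n)

end QuasiDiffusion

end

/-! Given exactly one jump out of `x_0`, the level `t` of local time is crossed during the second
sojourn at `x_0`, so `τ⁻¹(t) - t` is the length of the single excursion between the two sojourns. Up
to a null set the event is the disjoint union over `n` of the sets `returnEvent`: the chain first
returns to `x_0` in step `n + 1`, and `T 0 ≤ t < T 0 + T (n + 1)`. Given the chain, the holding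
times are independent, and the time condition involves only the two sojourns at `x_0`. Hence it
contributes the same factor `q`, `secondSojournProb`, for every `n` and every excursion
(`setLIntegral_returnEvent`), and `q` cancels on conditioning.

What remains is the Laplace transform `f 1` of the time to reach `x_0` from `x_1`. A first-step
analysis gives `f 0 = 1`, `f k = a k / (z + a k) * (f (k - 1) + f (k + 1)) / 2` in the interior and
`f N = a N / (z + a N) * f (N - 1)`. The ratios `f k / f (k - 1)` then satisfy a one-step recursion,
which is the continued fraction. The proof goes backwards: `exists_hitting_transform` builds a
solution in `[0, 1]` from the fraction, and `tsum_first_passage` identifies it with the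
probabilistic quantity, because the weight of long paths avoiding `x_0` vanishes.

That decay comes from the superharmonic function of `exists_superharmonic`. It also shows that the
time spent at `x_0` is a.s. unbounded (`ae_exists_lt_timeAt`), so `τ⁻¹(t)` is finite. Only finitely
many sojourns matter on each path, so explosion never has to be excluded. -/

namespace QuasiDiffusion

/-! ### The exponential distribution -/

lemma expMeasure_Ioi {r : ℝ} (hr : 0 < r) (t : ℝ) :
    expMeasure r (Set.Ioi t) = ENNReal.ofReal (Real.exp (-(r * max t 0))) := by
  have := isProbabilityMeasure_expMeasure hr
  rw [← Set.compl_Iic, prob_compl_eq_one_sub measurableSet_Iic, ← ofReal_cdf,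
    cdf_expMeasure_eq hr, ← ENNReal.ofReal_one, ← ENNReal.ofReal_sub]
  · congr 1
    split_ifs with h
    · rw [max_eq_left h]; ring
    · rw [max_eq_right (le_of_not_ge h)]; simp
  · split_ifs with h
    · have : Real.exp (-(r * t)) ≤ 1 := by
        rw [Real.exp_le_one_iff]; nlinarith
      linarith
    · exact le_rfl

lemma expMeasure_eq_withDensity (r : ℝ) :
    expMeasure r = volume.withDensity (exponentialPDF r) := rfl

lemma measurable_exponentialPDF (r : ℝ) : Measurable (exponentialPDF r) :=
  (measurable_exponentialPDFReal r).ennreal_ofReal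

/-- Tilting the exponential density of rate `r` by `exp (-(z * s))` gives `r / (z + r)` times the
density of rate `z + r`. -/
lemma lintegral_exp_neg_mul_expMeasure {r z : ℝ} (hr : 0 < r) (hz : 0 ≤ z) :
    ∫⁻ s, ENNReal.ofReal (Real.exp (-(z * s))) ∂(expMeasure r) = ENNReal.ofReal (r / (z + r)) := by
  have hzr : 0 < z + r := by linarith
  rw [expMeasure_eq_withDensity, lintegral_withDensity_eq_lintegral_mul _
    (measurable_exponentialPDF r) (by fun_prop)]
  have : ∀ s, (exponentialPDF r * fun s => ENNReal.ofReal (Real.exp (-(z * s)))) s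
      = ENNReal.ofReal (r / (z + r)) * exponentialPDF (z + r) s := by
    intro s
    simp only [Pi.mul_apply, exponentialPDF_eq]
    split_ifs with h
    · rw [← ENNReal.ofReal_mul (by positivity), ← ENNReal.ofReal_mul (by positivity)]
      congr 1
      rw [← mul_assoc, div_mul_cancel₀ _ hzr.ne', mul_assoc, ← Real.exp_add]
      ring_nf
    · simp
  simp_rw [this]
  rw [lintegral_const_mul _ (measurable_exponentialPDF _), lintegral_exponentialPDF_eq_one hzr,
    mul_one]

/-! ### Jump chains with exponential holding times on a finite set -/

section JumpHold

variable {S : Type*} [Fintype S] [DecidableEq S] [MeasurableSpace S] [MeasurableSingletonClass S]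

/-- `Y` is a Markov chain started at `s₀` with transition matrix `p`, and given `Y` the holding
times `T n` are independent and exponential with rates `a (Y n)`. -/
structure IsJumpHold {Ω : Type*} [MeasurableSpace Ω] (P : Measure Ω) (s₀ : S) (p : S → S → ℝ)
    (a : S → ℝ) (Y : ℕ → Ω → S) (T : ℕ → Ω → ℝ≥0) : Prop where
  measurable_chain : ∀ n, Measurable (Y n)
  measurable_time : ∀ n, Measurable (T n)
  nonneg : ∀ x y, 0 ≤ p x y
  sum_eq_one : ∀ x, ∑ y, p x y = 1
  rate_pos : ∀ x, 0 < a x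
  measure_box : ∀ (n : ℕ) (i : ℕ → S) (t : ℕ → ℝ≥0),
      P.real {ω | ∀ k ≤ n, Y k ω = i k ∧ t k < T k ω} =
        (if i 0 = s₀ then 1 else 0)
          * (∏ k ∈ Finset.range n, p (i k) (i (k + 1)))
          * ∏ k ∈ Finset.range (n + 1), Real.exp (-(a (i k) * (t k : ℝ)))

/-- The probability of a finite path of the chain started at `s₀`. -/
noncomputable def pathProb (s₀ : S) (p : S → S → ℝ) {n : ℕ} (i : Fin (n + 1) → S) : ℝ≥0∞ :=
  (if i 0 = s₀ then 1 else 0) * ∏ k : Fin n, ENNReal.ofReal (p (i k.castSucc) (i k.succ))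

/-- The total weight of the paths of the chain that end at a given point after `n` steps, where a
visit to `x` in step `k` contributes the factor `w k x`. -/
noncomputable def pathSum (s₀ : S) (p : S → S → ℝ) (w : ℕ → S → ℝ≥0∞) : ℕ → S → ℝ≥0∞
  | 0, y => if y = s₀ then w 0 y else 0
  | n + 1, y => (∑ x, pathSum s₀ p w n x * ENNReal.ofReal (p x y)) * w (n + 1) y

-- Splitting off the last point of a path turns the recursion into an enumeration of paths. The
-- enumeration matches the joint law; the recursion is what the later estimates use.
omit [MeasurableSpace S] [MeasurableSingletonClass S] in
lemma pathSum_eq_sum (s₀ : S) (p : S → S → ℝ) (w : ℕ → S → ℝ≥0∞) (n : ℕ) (y : S) :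
    pathSum s₀ p w n y = ∑ i : Fin (n + 1) → S,
      if i (Fin.last n) = y then pathProb s₀ p i * ∏ k : Fin (n + 1), w k (i k) else 0 := by
  induction n generalizing y with
  | zero =>
    rw [← (Equiv.funUnique (Fin 1) S).symm.sum_comp]
    simp [pathSum, pathProb]
  | succ n ih =>
    rw [← (Fin.snocEquiv (fun _ : Fin (n + 2) => S)).sum_comp, Fintype.sum_prod_type]
    rw [Finset.sum_eq_single y]
    · simp only [pathSum, ih, Finset.sum_mul]
      rw [Finset.sum_comm]
      refine Finset.sum_congr rfl fun i _ => ?_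
      simp only [ite_mul, zero_mul, Finset.sum_ite_eq, Finset.mem_univ, if_true]
      have h0 : (Fin.snoc (α := fun _ : Fin (n + 2) => S) i y : Fin (n + 2) → S) 0 = i 0 := by
        have := Fin.snoc_castSucc (α := fun _ : Fin (n + 2) => S) y i 0
        exact this
      simp only [Fin.snocEquiv_apply, Fin.snoc_last, if_true, pathProb, h0]
      rw [Fin.prod_univ_castSucc (f := fun k : Fin (n + 2) => w k _),
        Fin.prod_univ_castSucc (f := fun k : Fin (n + 1) => ENNReal.ofReal _)]
      simp only [← Fin.castSucc_succ, Fin.succ_last, Fin.snoc_castSucc, Fin.snoc_last,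
        Fin.val_castSucc, Fin.val_last]
      ring
    · intro x _ hx
      refine Finset.sum_eq_zero fun i _ => ?_
      simp [hx]
    · simp

omit [MeasurableSpace S] [MeasurableSingletonClass S] in
lemma sum_pathSum (s₀ : S) (p : S → S → ℝ) (w : ℕ → S → ℝ≥0∞) (n : ℕ) :
    ∑ y, pathSum s₀ p w n y = ∑ i : Fin (n + 1) → S,
      pathProb s₀ p i * ∏ k : Fin (n + 1), w k (i k) := by
  simp_rw [pathSum_eq_sum]
  rw [Finset.sum_comm]
  simp

omit [MeasurableSpace S] [MeasurableSingletonClass S] in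
lemma sum_pathProb (s₀ : S) (p : S → S → ℝ) (hp : ∀ x y, 0 ≤ p x y) (hs : ∀ x, ∑ y, p x y = 1)
    (n : ℕ) : ∑ i : Fin (n + 1) → S, pathProb s₀ p i = 1 := by
  have h := sum_pathSum s₀ p (fun _ _ => 1) n
  simp only [Finset.prod_const_one, mul_one] at h
  rw [← h]
  clear h
  induction n with
  | zero => simp [pathSum]
  | succ n ih =>
    simp only [pathSum, mul_one]
    rw [Finset.sum_comm]
    simp_rw [← Finset.mul_sum]
    have : ∀ x, ∑ y, ENNReal.ofReal (p x y) = 1 := fun x => by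
      rw [← ENNReal.ofReal_sum_of_nonneg (fun y _ => hp x y), hs, ENNReal.ofReal_one]
    simp_rw [this, mul_one, ih]

omit [Fintype S] [MeasurableSpace S] [MeasurableSingletonClass S] in
lemma pathProb_ne_top (s₀ : S) (p : S → S → ℝ) {n : ℕ} (i : Fin (n + 1) → S) :
    pathProb s₀ p i ≠ ∞ := by
  unfold pathProb
  refine ENNReal.mul_ne_top (by split_ifs <;> simp) ?_
  exact ENNReal.prod_ne_top fun k _ => ENNReal.ofReal_ne_top

/-! ### Joint law of the chain and the holding times. -/

namespace IsJumpHold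

variable {Ω : Type*} [MeasurableSpace Ω] {P : Measure Ω} [IsProbabilityMeasure P] {s₀ : S}
  {p : S → S → ℝ} {a : S → ℝ} {Y : ℕ → Ω → S} {T : ℕ → Ω → ℝ≥0}

lemma setOf_forall_fin {Ω : Type*} (n : ℕ) (Q : ℕ → Ω → Prop) :
    {ω | ∀ k : Fin (n + 1), Q k ω} = {ω | ∀ k ≤ n, Q k ω} := by
  ext ω
  simp only [Set.mem_ofPred_eq]
  exact ⟨fun h k hk => h ⟨k, by omega⟩, fun h k => h k (by omega)⟩

omit [MeasurableSingletonClass S] in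
lemma measure_fin_box (h : IsJumpHold P s₀ p a Y T) {n : ℕ} (i : Fin (n + 1) → S)
    (t : Fin (n + 1) → ℝ≥0) :
    P {ω | ∀ k : Fin (n + 1), Y k ω = i k ∧ t k < T k ω} =
      pathProb s₀ p i * ∏ k, expMeasure (a (i k)) (Set.Ioi (t k : ℝ)) := by
  have hb := h.measure_box n (fun k => i (Fin.ofNat (n + 1) k)) (fun k => t (Fin.ofNat (n + 1) k))
  have hof : ∀ k : Fin (n + 1), Fin.ofNat (n + 1) (k : ℕ) = k := fun k => by
    ext; simp [Fin.ofNat, Nat.mod_eq_of_lt k.2]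
  have hset : {ω | ∀ k : Fin (n + 1), Y k ω = i k ∧ t k < T k ω} =
      {ω | ∀ k ≤ n, Y k ω = i (Fin.ofNat (n + 1) k) ∧ t (Fin.ofNat (n + 1) k) < T k ω} := by
    rw [← setOf_forall_fin n
      (fun k ω => Y k ω = i (Fin.ofNat (n + 1) k) ∧ t (Fin.ofNat (n + 1) k) < T k ω)]
    simp only [hof]
  rw [hset, ← ENNReal.ofReal_toReal (measure_ne_top P _)]
  rw [measureReal_def] at hb
  rw [hb, Finset.prod_range, Finset.prod_range]
  have h1 : ∀ k : Fin n, Fin.ofNat (n + 1) (k : ℕ) = k.castSucc := fun k => hof k.castSucc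
  have h2 : ∀ k : Fin n, Fin.ofNat (n + 1) ((k : ℕ) + 1) = k.succ := fun k => hof k.succ
  have h3 : Fin.ofNat (n + 1) 0 = 0 := hof 0
  simp only [hof, h1, h2, h3, expMeasure_Ioi (h.rate_pos _), NNReal.coe_nonneg, max_eq_left]
  have hn : (0 : ℝ) ≤ if i 0 = s₀ then 1 else 0 := by split_ifs <;> norm_num
  rw [ENNReal.ofReal_mul (mul_nonneg hn (Finset.prod_nonneg fun _ _ => h.nonneg _ _)),
    ENNReal.ofReal_mul hn, ENNReal.ofReal_prod_of_nonneg (fun _ _ => h.nonneg _ _),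
    ENNReal.ofReal_prod_of_nonneg (fun _ _ => (Real.exp_pos _).le), pathProb]
  congr 2
  split_ifs <;> simp

omit [IsProbabilityMeasure P] in
lemma measurableSet_path (h : IsJumpHold P s₀ p a Y T) {n : ℕ} (i : Fin (n + 1) → S) :
    MeasurableSet {ω | ∀ k : Fin (n + 1), Y k ω = i k} := by
  rw [Set.ofPred_forall]
  exact MeasurableSet.iInter fun k => h.measurable_chain k (measurableSet_singleton (i k))

omit [MeasurableSingletonClass S] in
lemma measure_path_pos (h : IsJumpHold P s₀ p a Y T) {n : ℕ} (i : Fin (n + 1) → S) :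
    P {ω | ∀ k : Fin (n + 1), Y k ω = i k ∧ 0 < T k ω} = pathProb s₀ p i := by
  have := h.measure_fin_box i (fun _ => 0)
  simpa [expMeasure_Ioi (h.rate_pos _)] using this

/-- The boxes with all thresholds zero are disjoint for different paths, and their probabilities
already add up to one. -/
lemma ae_time_pos (h : IsJumpHold P s₀ p a Y T) : ∀ᵐ ω ∂P, ∀ n, 0 < T n ω := by
  rw [ae_all_iff]
  intro n
  have hm : ∀ i : Fin (n + 1) → S,
      MeasurableSet {ω | ∀ k : Fin (n + 1), Y k ω = i k ∧ 0 < T k ω} := fun i => by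
    rw [Set.ofPred_forall]
    exact MeasurableSet.iInter fun k => (h.measurable_chain k (measurableSet_singleton (i k))).inter
      (measurableSet_lt (f := fun _ => (0 : ℝ≥0)) measurable_const (h.measurable_time k))
  have h1 : P (⋃ i : Fin (n + 1) → S, {ω | ∀ k : Fin (n + 1), Y k ω = i k ∧ 0 < T k ω}) = 1 := by
    rw [measure_iUnion _ hm, tsum_fintype]
    · simp_rw [h.measure_path_pos]
      exact sum_pathProb s₀ p h.nonneg h.sum_eq_one n
    · intro i j hij
      refine Set.disjoint_left.2 fun ω hi hj => hij ?_
      ext k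
      rw [← (hi k).1, ← (hj k).1]
  have h2 := (prob_compl_eq_zero_iff (MeasurableSet.iUnion hm)).2 h1
  refine ae_iff.2 (measure_mono_null ?_ h2)
  intro ω hω hc
  obtain ⟨i, hi⟩ := Set.mem_iUnion.1 hc
  exact hω (by simpa using (hi (Fin.last n)).2)

lemma ae_pathProb_ne_zero (h : IsJumpHold P s₀ p a Y T) :
    ∀ᵐ ω ∂P, ∀ n, pathProb s₀ p (fun k : Fin (n + 1) => Y k ω) ≠ 0 := by
  have : ∀ᵐ ω ∂P, ∀ (n : ℕ) (i : Fin (n + 1) → S), pathProb s₀ p i = 0 →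
      ¬ ∀ k : Fin (n + 1), Y k ω = i k ∧ 0 < T k ω := by
    rw [ae_all_iff]
    intro n
    rw [ae_all_iff]
    intro i
    by_cases hi : pathProb s₀ p i = 0
    · rw [← h.measure_path_pos i] at hi
      filter_upwards [measure_eq_zero_iff_ae_notMem.1 hi] with ω hω _ using hω
    · simp [hi]
  filter_upwards [this, h.ae_time_pos] with ω h1 h2 n h0
  exact h1 n _ h0 fun k => ⟨rfl, h2 k⟩

lemma ae_start (h : IsJumpHold P s₀ p a Y T) : ∀ᵐ ω ∂P, Y 0 ω = s₀ := by
  filter_upwards [h.ae_pathProb_ne_zero] with ω hω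
  have := hω 0
  by_contra h0
  simp [pathProb, h0] at this

lemma ae_step (h : IsJumpHold P s₀ p a Y T) : ∀ᵐ ω ∂P, ∀ n, p (Y n ω) (Y (n + 1) ω) ≠ 0 := by
  filter_upwards [h.ae_pathProb_ne_zero] with ω hω n h0
  refine hω (n + 1) ?_
  rw [pathProb, Finset.prod_eq_zero (Finset.mem_univ (Fin.last n)), mul_zero]
  simp [h0]

/-- Upper orthants form a π-system that generates the product σ-algebra, and `measure_box` gives
their measures. -/
lemma map_restrict_path (h : IsJumpHold P s₀ p a Y T) {n : ℕ} (i : Fin (n + 1) → S) :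
    (P.restrict {ω | ∀ k : Fin (n + 1), Y k ω = i k}).map
      (fun ω (k : Fin (n + 1)) => (T k ω : ℝ)) =
      pathProb s₀ p i • Measure.pi (fun k => expMeasure (a (i k))) := by
  have hprob : ∀ x, IsProbabilityMeasure (expMeasure (a x)) := fun x =>
    isProbabilityMeasure_expMeasure (h.rate_pos x)
  have hmT : Measurable (fun ω (k : Fin (n + 1)) => (T k ω : ℝ)) :=
    measurable_pi_lambda _ fun k => (h.measurable_time k).coe_nnreal_real
  have hbox : ∀ t : Fin (n + 1) → ℝ,
      (P.restrict {ω | ∀ k : Fin (n + 1), Y k ω = i k}).map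
        (fun ω (k : Fin (n + 1)) => (T k ω : ℝ)) (Set.univ.pi fun k => Set.Ioi (t k)) =
      pathProb s₀ p i * ∏ k, expMeasure (a (i k)) (Set.Ioi (t k)) := by
    intro t
    rw [Measure.map_apply hmT (MeasurableSet.univ_pi fun k => measurableSet_Ioi),
      Measure.restrict_apply (hmT (MeasurableSet.univ_pi fun k => measurableSet_Ioi))]
    have := h.measure_fin_box i (fun k => (t k).toNNReal)
    simp only [expMeasure_Ioi (h.rate_pos _), Real.coe_toNNReal'] at this ⊢
    simp only [max_assoc, max_self] at this
    rw [← this]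
    refine measure_congr ?_
    -- Negative thresholds are truncated to zero, which changes nothing since the holding times are
    -- a.s. positive.
    filter_upwards [h.ae_time_pos] with ω hω
    refine propext ?_
    change ((fun (k : Fin (n + 1)) => (T k ω : ℝ)) ∈ (Set.univ.pi fun k => Set.Ioi (t k)) ∧
      ∀ k : Fin (n + 1), Y k ω = i k) ↔ ∀ k : Fin (n + 1), Y k ω = i k ∧ (t k).toNNReal < T k ω
    simp only [Set.mem_univ_pi, Set.mem_Ioi]
    have hk : ∀ k : Fin (n + 1), ((t k).toNNReal < T k ω ↔ t k < T k ω) := fun k => by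
      rw [← NNReal.coe_lt_coe, Real.coe_toNNReal', max_lt_iff]
      exact and_iff_left (by exact_mod_cast hω k)
    simp only [hk]
    exact ⟨fun H k => ⟨H.2 k, H.1 k⟩, fun H => ⟨fun k => (H k).2, fun k => (H k).1⟩⟩
  -- The uniqueness theorem is for the product measure itself, so one divides by the path
  -- probability; if that is zero, both sides vanish.
  by_cases h0 : pathProb s₀ p i = 0
  · have hz : P {ω | ∀ k : Fin (n + 1), Y k ω = i k} = 0 := by
      rw [← h0, ← h.measure_path_pos i]
      refine measure_congr ?_
      filter_upwards [h.ae_time_pos] with ω hω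
      refine propext ?_
      change (∀ k : Fin (n + 1), Y k ω = i k) ↔ ∀ k : Fin (n + 1), Y k ω = i k ∧ 0 < T k ω
      simp [hω]
    rw [h0, zero_smul, Measure.restrict_eq_zero.2 hz, Measure.map_zero]
  · have hpi : Measure.pi (fun k => expMeasure (a (i k))) = (pathProb s₀ p i)⁻¹ •
        (P.restrict {ω | ∀ k : Fin (n + 1), Y k ω = i k}).map
          (fun ω (k : Fin (n + 1)) => (T k ω : ℝ)) := by
      refine Measure.pi_eq_generateFrom (C := fun _ => Set.range Set.Ioi) (fun _ => ?_)
        (fun _ => isPiSystem_Ioi) (fun k => ?_) (fun s hs => ?_)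
      · rw [← borel_eq_generateFrom_Ioi, ← BorelSpace.measurable_eq]
      · exact ⟨fun n => Set.Ioi (-(n : ℝ)), fun n => ⟨_, rfl⟩, fun n => measure_lt_top _ _, by
          refine Set.eq_univ_of_forall fun x => Set.mem_iUnion.2 ?_
          obtain ⟨n, hn⟩ := exists_nat_gt (-x)
          exact ⟨n, by simp only [Set.mem_Ioi]; linarith⟩⟩
      · choose t ht using hs
        obtain rfl : (fun k => Set.Ioi (t k)) = s := funext ht
        rw [Measure.smul_apply, hbox, smul_eq_mul, ← mul_assoc,
          ENNReal.inv_mul_cancel h0 (pathProb_ne_top _ _ _), one_mul]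
    rw [hpi, smul_smul, ENNReal.mul_inv_cancel h0 (pathProb_ne_top _ _ _), one_smul]

/-- The expectation of a product of functions of the successive positions and holding times. -/
lemma lintegral_prod (h : IsJumpHold P s₀ p a Y T) (φ : ℕ → S → ℝ → ℝ≥0∞)
    (hφ : ∀ k x, Measurable (φ k x)) (n : ℕ) :
    ∫⁻ ω, ∏ k ∈ Finset.range (n + 1), φ k (Y k ω) (T k ω) ∂P =
      ∑ y, pathSum s₀ p (fun k x => ∫⁻ s, φ k x s ∂(expMeasure (a x))) n y := by
  have hprob : ∀ x, IsProbabilityMeasure (expMeasure (a x)) := fun x =>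
    isProbabilityMeasure_expMeasure (h.rate_pos x)
  have hmT : Measurable (fun ω (k : Fin (n + 1)) => (T k ω : ℝ)) :=
    measurable_pi_lambda _ fun k => (h.measurable_time k).coe_nnreal_real
  have hU : (⋃ i : Fin (n + 1) → S, {ω | ∀ k : Fin (n + 1), Y k ω = i k}) = Set.univ :=
    Set.eq_univ_of_forall fun ω => Set.mem_iUnion.2 ⟨fun k => Y k ω, fun k => rfl⟩
  rw [sum_pathSum, ← setLIntegral_univ, ← hU,
    lintegral_iUnion (fun i => h.measurableSet_path i), tsum_fintype]
  · refine Finset.sum_congr rfl fun i _ => ?_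
    have hpm : ∀ k : Fin (n + 1), Measurable (φ k (i k)) := fun k => hφ k (i k)
    have h1 : ∫⁻ ω in {ω | ∀ k : Fin (n + 1), Y k ω = i k},
          ∏ k ∈ Finset.range (n + 1), φ k (Y k ω) (T k ω) ∂P =
        ∫⁻ ω in {ω | ∀ k : Fin (n + 1), Y k ω = i k},
          (fun τ : Fin (n + 1) → ℝ => ∏ k : Fin (n + 1), φ k (i k) (τ k))
            (fun k : Fin (n + 1) => (T k ω : ℝ)) ∂P := by
      refine setLIntegral_congr_fun (h.measurableSet_path i) fun ω hω => ?_
      rw [Finset.prod_range]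
      exact Finset.prod_congr rfl fun k _ => by rw [hω k]
    have h2 : Measurable fun τ : Fin (n + 1) → ℝ => ∏ k : Fin (n + 1), φ k (i k) (τ k) :=
      Finset.measurable_prod _ fun k _ => (hpm k).comp (measurable_pi_apply k)
    rw [h1, ← lintegral_map h2 hmT, h.map_restrict_path, lintegral_smul_measure,
      smul_eq_mul]
    congr 1
    rw [lintegral_prod_eq_prod_lintegral_of_indepFun Finset.univ
      (fun (k : Fin (n + 1)) (τ : Fin (n + 1) → ℝ) => φ k (i k) (τ k))
      (iIndepFun_pi fun k => (hpm k).aemeasurable)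
      (fun k => (hpm k).comp (measurable_pi_apply k))]
    refine Finset.prod_congr rfl fun k _ => ?_
    exact (measurePreserving_eval (fun k => expMeasure (a (i k))) k).lintegral_comp (hpm k)
  · intro i j hij
    refine Set.disjoint_left.2 fun ω hi hj => hij ?_
    ext k
    rw [← hi k, ← hj k]

end IsJumpHold

end JumpHold

end QuasiDiffusion

namespace QuasiDiffusion

/-! ### Local time of a step path -/

lemma image_coe_Ico (s s' : ℝ≥0) :
    (fun r : ℝ≥0 => (r : ℝ)) '' Set.Ico s s' = Set.Ico (s : ℝ) s' := by
  ext x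
  constructor
  · rintro ⟨r, ⟨h1, h2⟩, rfl⟩
    exact ⟨by exact_mod_cast h1, by exact_mod_cast h2⟩
  · rintro ⟨h1, h2⟩
    exact ⟨⟨x, s.2.trans h1⟩, ⟨by exact_mod_cast h1, by exact_mod_cast h2⟩, rfl⟩

/-- The path is arbitrary, so its level set need not be measurable; Carathéodory's criterion only
asks this of the half-line that cuts it. -/
lemma localTime_eq_add (w : ℝ≥0 → ℝ) (b : ℝ) {s s' : ℝ≥0} (hs : s ≤ s') :
    localTime w b s' = localTime w b s +
      volume ((fun r : ℝ≥0 => (r : ℝ)) '' {r : ℝ≥0 | s ≤ r ∧ r < s' ∧ w r = b}) := by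
  unfold localTime
  rw [← measure_inter_add_sdiff _ (measurableSet_Iio (a := (s : ℝ)))]
  congr 2
  · ext x
    constructor
    · rintro ⟨⟨r, ⟨_, h2⟩, rfl⟩, h3⟩
      exact ⟨r, ⟨by exact_mod_cast h3, h2⟩, rfl⟩
    · rintro ⟨r, ⟨h1, h2⟩, rfl⟩
      exact ⟨⟨r, ⟨h1.trans_le hs, h2⟩, rfl⟩, by exact_mod_cast h1⟩
  · ext x
    constructor
    · rintro ⟨⟨r, ⟨h1, h2⟩, rfl⟩, h3⟩
      exact ⟨r, ⟨not_lt.1 fun h => h3 (by exact_mod_cast h), h1, h2⟩, rfl⟩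
    · rintro ⟨r, ⟨h0, h1, h2⟩, rfl⟩
      exact ⟨⟨r, ⟨h1, h2⟩, rfl⟩, fun h => absurd (by exact_mod_cast h : r < s) (not_lt.2 h0)⟩

lemma localTime_mono (w : ℝ≥0 → ℝ) (b : ℝ) {s s' : ℝ≥0} (hs : s ≤ s') :
    localTime w b s ≤ localTime w b s' := by
  rw [localTime_eq_add w b hs]
  exact le_self_add

lemma localTime_of_eq {w : ℝ≥0 → ℝ} {b c : ℝ} {s s' : ℝ≥0} (hs : s ≤ s')
    (hw : ∀ r, s ≤ r → r < s' → w r = c) :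
    localTime w b s' = localTime w b s + if c = b then ((s' - s : ℝ≥0) : ℝ≥0∞) else 0 := by
  rw [localTime_eq_add w b hs]
  congr 1
  split_ifs with hc
  · have : {r : ℝ≥0 | s ≤ r ∧ r < s' ∧ w r = b} = Set.Ico s s' := by
      ext r
      exact ⟨fun h => ⟨h.1, h.2.1⟩, fun h => ⟨h.1, h.2, (hw r h.1 h.2).trans hc⟩⟩
    rw [this, image_coe_Ico, Real.volume_Ico, ← NNReal.coe_sub hs, ENNReal.ofReal_coe_nnreal]
  · have : {r : ℝ≥0 | s ≤ r ∧ r < s' ∧ w r = b} = ∅ := by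
      ext r
      simp only [Set.mem_ofPred_eq, Set.mem_empty_iff_false, iff_false]
      rintro ⟨h1, h2, h3⟩
      exact hc ((hw r h1 h2).symm.trans h3)
    rw [this, Set.image_empty, measure_empty]

/-- `w` is the right-continuous step path that takes the value `u n` during the `n`-th sojourn,
which lasts for a time `T n`. -/
structure IsStepPath (w : ℝ≥0 → ℝ) (u : ℕ → ℝ) (T : ℕ → ℝ≥0) : Prop where
  time_pos : ∀ n, 0 < T n
  eq_of_mem : ∀ (n : ℕ) (s : ℝ≥0), ∑ k ∈ Finset.range n, T k ≤ s →
    s < ∑ k ∈ Finset.range (n + 1), T k → w s = u n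

/-- The total time spent at `b` during the first `n` sojourns. -/
noncomputable def timeAt (u : ℕ → ℝ) (T : ℕ → ℝ≥0) (b : ℝ) (n : ℕ) : ℝ≥0 :=
  ∑ k ∈ Finset.range n, if u k = b then T k else 0

/-! ### Inverse local time and jump count of a step path. -/

namespace IsStepPath

variable {w : ℝ≥0 → ℝ} {u : ℕ → ℝ} {T : ℕ → ℝ≥0} {b b' : ℝ}

lemma strictMono_sum (h : IsStepPath w u T) :
    StrictMono fun n => ∑ k ∈ Finset.range n, T k :=
  strictMono_nat_of_lt_succ fun n => by
    rw [Finset.sum_range_succ]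
    exact lt_add_of_pos_right _ (h.time_pos n)

lemma localTime_add (h : IsStepPath w u T) (b : ℝ) (n : ℕ) {s : ℝ≥0} (hs : s ≤ T n) :
    localTime w b (∑ k ∈ Finset.range n, T k + s) =
      localTime w b (∑ k ∈ Finset.range n, T k) + if u n = b then (s : ℝ≥0∞) else 0 := by
  rw [localTime_of_eq (c := u n) (le_self_add : ∑ k ∈ Finset.range n, T k ≤ _ + s)
    (fun r h1 h2 => h.eq_of_mem n r h1 (h2.trans_le ?_)), add_tsub_cancel_left]
  rw [Finset.sum_range_succ]
  gcongr

lemma localTime_sum (h : IsStepPath w u T) (b : ℝ) (n : ℕ) :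
    localTime w b (∑ k ∈ Finset.range n, T k) = timeAt u T b n := by
  induction n with
  | zero => simp [localTime, timeAt]
  | succ n ih =>
    rw [Finset.sum_range_succ, h.localTime_add b n le_rfl, ih, timeAt, timeAt,
      Finset.sum_range_succ]
    push_cast
    split_ifs <;> simp

lemma eq_of_timeAt (u : ℕ → ℝ) (T : ℕ → ℝ≥0) {n : ℕ} {t : ℝ≥0} (h1 : timeAt u T b n ≤ t)
    (h2 : t < timeAt u T b (n + 1)) : u n = b := by
  by_contra hc
  rw [timeAt, Finset.sum_range_succ, if_neg hc, add_zero] at h2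
  exact absurd h1 (not_le.2 h2)

lemma lt_of_timeAt (u : ℕ → ℝ) (T : ℕ → ℝ≥0) {n : ℕ} {t : ℝ≥0} (h1 : timeAt u T b n ≤ t)
    (h2 : t < timeAt u T b (n + 1)) : t - timeAt u T b n < T n := by
  have hu := eq_of_timeAt u T h1 h2
  rw [tsub_lt_iff_left h1]
  rwa [timeAt, Finset.sum_range_succ, if_pos hu] at h2

lemma exists_timeAt_le_lt {u : ℕ → ℝ} {T : ℕ → ℝ≥0} {b : ℝ} {t : ℝ≥0}
    (ht : ∃ n, t < timeAt u T b n) :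
    ∃ n, timeAt u T b n ≤ t ∧ t < timeAt u T b (n + 1) := by
  classical
  obtain ⟨n, hn⟩ : ∃ n, Nat.find ht = n + 1 := by
    refine Nat.exists_eq_succ_of_ne_zero fun hz => ?_
    have := Nat.find_spec ht
    rw [hz] at this
    simp [timeAt] at this
  exact ⟨n, not_lt.1 (Nat.find_min ht (by omega)), hn ▸ Nat.find_spec ht⟩

/-- The clock at `b` runs at unit speed during sojourn `n`, so the level `t` is crossed after `t -
timeAt u T b n` of that sojourn. -/
lemma invLocalTime_eq (h : IsStepPath w u T) {n : ℕ} {t : ℝ≥0} (h1 : timeAt u T b n ≤ t)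
    (h2 : t < timeAt u T b (n + 1)) :
    invLocalTime w b t = (∑ k ∈ Finset.range n, T k + (t - timeAt u T b n) : ℝ≥0) := by
  have hu := eq_of_timeAt u T h1 h2
  have hlt := lt_of_timeAt u T h1 h2
  refine le_antisymm ?_ (le_iInf₂ fun s hs => ?_)
  · by_contra hc
    obtain ⟨c, hc1, hc2⟩ := ENNReal.lt_iff_exists_nnreal_btwn.1 (not_le.1 hc)
    rw [ENNReal.coe_lt_coe] at hc1
    have hS : (∑ k ∈ Finset.range n, T k) ≤ c := le_self_add.trans hc1.le
    obtain ⟨d, rfl⟩ := exists_add_of_le hS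
    have hd : t - timeAt u T b n < d := (add_lt_add_iff_left _).1 hc1
    refine absurd hc2 (not_lt.2 ?_)
    -- The minimum with `T n` keeps the test time inside sojourn `n`, where the local time is
    -- explicit.
    refine (iInf₂_le (∑ k ∈ Finset.range n, T k + min d (T n)) ?_).trans
      (ENNReal.coe_le_coe.2 (by gcongr; exact min_le_left _ _))
    rw [h.localTime_add b n (min_le_right _ _), if_pos hu, h.localTime_sum,
      ← ENNReal.coe_add, ENNReal.coe_lt_coe]
    exact (tsub_lt_iff_left h1).1 (lt_min hd hlt)
  · by_contra hc
    rw [not_le, ENNReal.coe_lt_coe] at hc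
    have := hs.trans_le (localTime_mono w b hc.le)
    rw [h.localTime_add b n hlt.le, if_pos hu, h.localTime_sum, ← ENNReal.coe_add,
      add_tsub_cancel_of_le h1] at this
    exact lt_irrefl _ this

lemma eventually_nhdsLT (h : IsStepPath w u T) {n : ℕ} {s : ℝ≥0}
    (h1 : ∑ k ∈ Finset.range n, T k < s) (h2 : s ≤ ∑ k ∈ Finset.range (n + 1), T k) :
    ∀ᶠ r in 𝓝[<] s, w r = u n := by
  filter_upwards [Ioo_mem_nhdsLT h1] with r hr
  exact h.eq_of_mem n r hr.1.le (hr.2.trans_le h2)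

lemma exists_mem_sojourn (T : ℕ → ℝ≥0) {n : ℕ} {s : ℝ≥0}
    (hs : s < ∑ k ∈ Finset.range (n + 1), T k) : ∃ j ≤ n, ∑ k ∈ Finset.range j, T k ≤ s ∧
      s < ∑ k ∈ Finset.range (j + 1), T k := by
  induction n with
  | zero => exact ⟨0, le_rfl, by simp, hs⟩
  | succ n ih =>
    by_cases hn : s < ∑ k ∈ Finset.range (n + 1), T k
    · obtain ⟨j, hj, hj'⟩ := ih hn
      exact ⟨j, by omega, hj'⟩
    · exact ⟨n + 1, le_rfl, not_lt.1 hn, hs⟩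

/-- The counted jumps are the ends of sojourns at `b`. Sojourn `n` is still running when the level
`t` is crossed, so it does not count. -/
lemma jumpCount_eq (h : IsStepPath w u T) (hb : b ≠ b') (hstep : ∀ k, u k = b → u (k + 1) = b')
    {n : ℕ} {t : ℝ≥0} (h1 : timeAt u T b n ≤ t) (h2 : t < timeAt u T b (n + 1)) :
    jumpCount w b b' t = (((Finset.range n).filter fun k => u k = b).card : ℕ∞) := by
  have hlt := lt_of_timeAt u T h1 h2
  have hset : {s : ℝ≥0 | 0 < s ∧ (s : ℝ≥0∞) ≤ invLocalTime w b t ∧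
      (∀ᶠ r in 𝓝[<] s, w r = b) ∧ w s = b'} =
      (fun k => ∑ j ∈ Finset.range (k + 1), T j) ''
        ((Finset.range n).filter fun k => u k = b : Finset ℕ) := by
    rw [h.invLocalTime_eq h1 h2]
    ext s
    simp only [Set.mem_ofPred_eq, ENNReal.coe_le_coe, Set.mem_image, Finset.coe_filter,
      Finset.mem_range]
    constructor
    · rintro ⟨hs0, hs, hl, hr⟩
      have hsn : s < ∑ k ∈ Finset.range (n + 1), T k := by
        rw [Finset.sum_range_succ]
        exact hs.trans_lt (by gcongr)
      obtain ⟨j, hjn, hj1, hj2⟩ := exists_mem_sojourn T hsn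
      have : (𝓝[<] s).NeBot := nhdsLT_neBot_of_exists_lt ⟨0, hs0⟩
      -- A jump time must start a sojourn: strictly inside one, the left limit equals the value,
      -- against `b ≠ b'`. Sojourn `0` starts at time `0`, which is excluded.
      rcases hj1.eq_or_lt with hj | hj
      · obtain _ | j := j
        · simp only [Finset.range_zero, Finset.sum_empty] at hj
          exact absurd hj hs0.ne
        · refine ⟨j, ⟨by omega, ?_⟩, hj⟩
          obtain ⟨r, hr1, hr2⟩ :=
            ((h.eventually_nhdsLT (hj ▸ h.strictMono_sum j.lt_succ_self) hj.ge).and hl).exists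
          exact hr1.symm.trans hr2
      · obtain ⟨r, hr1, hr2⟩ := ((h.eventually_nhdsLT hj hj2.le).and hl).exists
        exact absurd ((hr2.symm.trans hr1).trans ((h.eq_of_mem j s hj1 hj2).symm.trans hr)) hb
    · rintro ⟨k, ⟨hk, hub⟩, rfl⟩
      refine ⟨?_, ?_, ?_, ?_⟩
      · rw [Finset.sum_range_succ]
        exact (h.time_pos k).trans_le le_add_self
      · exact (h.strictMono_sum.monotone (by omega : k + 1 ≤ n)).trans le_self_add
      · have := h.eventually_nhdsLT (n := k) (h.strictMono_sum k.lt_succ_self) le_rfl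
        rwa [hub] at this
      · rw [← hstep k hub]
        exact h.eq_of_mem (k + 1) _ le_rfl (h.strictMono_sum (k + 1).lt_succ_self)
  rw [jumpCount, hset, Function.Injective.encard_image, Set.encard_coe_eq_coe_finsetCard]
  exact fun i j hij => Nat.succ_injective (h.strictMono_sum.injective hij)

/-- If the first return to `b` takes place in step `n` and `t` is exceeded during the second sojourn
at `b`, then there is exactly one jump before the inverse local time. -/
lemma of_first_return (h : IsStepPath w u T) (hb : b ≠ b')
    (hstep : ∀ k, u k = b → u (k + 1) = b') (h0 : u 0 = b) {n : ℕ} (hn : 1 ≤ n)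
    (hne : ∀ k, 1 ≤ k → k < n → u k ≠ b) (hun : u n = b) {t : ℝ≥0} (h1 : T 0 ≤ t)
    (h2 : t < T 0 + T n) :
    jumpCount w b b' t = 1 ∧
      invLocalTime w b t = (t + ∑ k ∈ Finset.Ico 1 n, T k : ℝ≥0) := by
  have hL : timeAt u T b n = T 0 := by
    rw [timeAt, Finset.sum_eq_single 0, if_pos h0]
    · intro k hk hk0
      rw [if_neg (hne k (Nat.one_le_iff_ne_zero.2 hk0) (Finset.mem_range.1 hk))]
    · intro hk
      exact absurd (Finset.mem_range.2 hn) hk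
  have hL' : timeAt u T b (n + 1) = T 0 + T n := by
    rw [timeAt, Finset.sum_range_succ, if_pos hun, ← hL, timeAt]
  have hf : ((Finset.range n).filter fun k => u k = b) = {0} := by
    ext k
    simp only [Finset.mem_filter, Finset.mem_range, Finset.mem_singleton]
    constructor
    · rintro ⟨hk, hu⟩
      by_contra hk0
      exact hne k (Nat.one_le_iff_ne_zero.2 hk0) hk hu
    · rintro rfl
      exact ⟨hn, h0⟩
  rw [← hL] at h1
  rw [← hL'] at h2
  refine ⟨?_, ?_⟩
  · rw [h.jumpCount_eq hb hstep h1 h2, hf]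
    simp
  · rw [h.invLocalTime_eq h1 h2, hL, Finset.range_eq_Ico, Finset.sum_eq_sum_Ico_succ_bot hn,
      add_right_comm, add_tsub_cancel_of_le (hL ▸ h1)]

/-- If there is exactly one jump before the inverse local time, then `t` is exceeded during the
second sojourn at `b`. -/
lemma exists_first_return (h : IsStepPath w u T) (hb : b ≠ b')
    (hstep : ∀ k, u k = b → u (k + 1) = b') (h0 : u 0 = b) {t : ℝ≥0}
    (ht : ∃ n, t < timeAt u T b n) (hj : jumpCount w b b' t = 1) :
    ∃ n, 1 ≤ n ∧ (∀ k, 1 ≤ k → k < n → u k ≠ b) ∧ u n = b ∧ T 0 ≤ t ∧ t < T 0 + T n := by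
  obtain ⟨n, h1, h2⟩ := exists_timeAt_le_lt ht
  rw [h.jumpCount_eq hb hstep h1 h2] at hj
  have hj' : ((Finset.range n).filter fun k => u k = b).card = 1 := by exact_mod_cast hj
  obtain ⟨j, hj⟩ := Finset.card_eq_one.1 hj'
  have hn : 1 ≤ n := by
    rw [Nat.one_le_iff_ne_zero]
    rintro rfl
    simp at hj'
  have hj0 : j = 0 := by
    have : 0 ∈ ((Finset.range n).filter fun k => u k = b) :=
      Finset.mem_filter.2 ⟨Finset.mem_range.2 hn, h0⟩
    rw [hj] at this
    exact (Finset.mem_singleton.1 this).symm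
  subst hj0
  have hun := eq_of_timeAt u T h1 h2
  have hne : ∀ k, 1 ≤ k → k < n → u k ≠ b := fun k hk1 hkn hu => by
    have : k ∈ ((Finset.range n).filter fun k => u k = b) :=
      Finset.mem_filter.2 ⟨Finset.mem_range.2 hkn, hu⟩
    rw [hj, Finset.mem_singleton] at this
    omega
  have hL : timeAt u T b n = T 0 := by
    rw [timeAt, ← Finset.sum_filter, hj, Finset.sum_singleton]
  refine ⟨n, hn, hne, hun, hL ▸ h1, ?_⟩
  rwa [timeAt, Finset.sum_range_succ, if_pos hun, ← timeAt, hL] at h2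

end IsStepPath

end QuasiDiffusion

namespace QuasiDiffusion

/-! ### Weighted path sums -/

section PathSum

variable {S : Type*} [Fintype S] [DecidableEq S] {s₀ : S} {p : S → S → ℝ}

lemma pathSum_eq_const_mul {w w' : ℕ → S → ℝ≥0∞} {c : ℝ≥0∞} {n : ℕ} (h0 : w' 0 s₀ = c * w 0 s₀)
    (h : ∀ k < n, w' (k + 1) = w (k + 1)) (y : S) :
    pathSum s₀ p w' n y = c * pathSum s₀ p w n y := by
  induction n generalizing y with
  | zero =>
    simp only [pathSum]
    split_ifs with hy
    · subst hy
      exact h0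
    · simp
  | succ n ih =>
    simp only [pathSum, h n n.lt_succ_self]
    simp_rw [ih (fun k hk => h k (by omega)), mul_assoc, ← Finset.mul_sum, mul_assoc]

/-- `h` serves as a Lyapunov function: each step multiplies the `h`-weighted mass by at most `θ`. -/
lemma sum_pathSum_mul_le (hp : ∀ x y, 0 ≤ p x y) {w : ℕ → S → ℝ≥0∞} {ρ h : S → ℝ} {θ : ℝ}
    (hρ : ∀ x, 0 ≤ ρ x) (hh : ∀ x, 0 ≤ h x) (hθ : 0 ≤ θ)
    (hw : ∀ k x, w (k + 1) x ≤ ENNReal.ofReal (ρ x))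
    (hle : ∀ x, ∑ y, p x y * (ρ y * h y) ≤ θ * h x) (n : ℕ) :
    ∑ x, pathSum s₀ p w n x * ENNReal.ofReal (h x) ≤
      ENNReal.ofReal θ ^ n * (w 0 s₀ * ENNReal.ofReal (h s₀)) := by
  induction n with
  | zero => simp [pathSum]
  | succ n ih =>
    calc ∑ y, pathSum s₀ p w (n + 1) y * ENNReal.ofReal (h y)
        ≤ ∑ y, (∑ x, pathSum s₀ p w n x * ENNReal.ofReal (p x y)) * ENNReal.ofReal (ρ y) *
            ENNReal.ofReal (h y) := by
          simp only [pathSum]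
          gcongr with y
          exact hw n y
      _ = ∑ x, pathSum s₀ p w n x * ENNReal.ofReal (∑ y, p x y * (ρ y * h y)) := by
          simp_rw [Finset.sum_mul]
          rw [Finset.sum_comm]
          refine Finset.sum_congr rfl fun x _ => ?_
          rw [ENNReal.ofReal_sum_of_nonneg
            (fun y _ => mul_nonneg (hp x y) (mul_nonneg (hρ y) (hh y))), Finset.mul_sum]
          refine Finset.sum_congr rfl fun y _ => ?_
          rw [ENNReal.ofReal_mul (hp x y), ENNReal.ofReal_mul (hρ y)]
          ring
      _ ≤ ∑ x, pathSum s₀ p w n x * ENNReal.ofReal (θ * h x) := by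
          gcongr with x
          exact hle x
      _ = ENNReal.ofReal θ * ∑ x, pathSum s₀ p w n x * ENNReal.ofReal (h x) := by
          rw [Finset.mul_sum]
          refine Finset.sum_congr rfl fun x _ => ?_
          rw [ENNReal.ofReal_mul hθ]
          ring
      _ ≤ ENNReal.ofReal θ ^ (n + 1) * (w 0 s₀ * ENNReal.ofReal (h s₀)) := by
          rw [pow_succ', mul_assoc]
          gcongr

lemma tendsto_sum_pathSum (hp : ∀ x y, 0 ≤ p x y) {w : ℕ → S → ℝ≥0∞} {ρ h : S → ℝ} {θ : ℝ}
    (hρ : ∀ x, 0 ≤ ρ x) (hh : ∀ x, 1 ≤ h x) (hθ : 0 ≤ θ) (hθ1 : θ < 1)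
    (hw₀ : w 0 s₀ ≠ ∞) (hw : ∀ k x, w (k + 1) x ≤ ENNReal.ofReal (ρ x))
    (hle : ∀ x, ∑ y, p x y * (ρ y * h y) ≤ θ * h x) :
    Tendsto (fun n => ∑ x, pathSum s₀ p w n x) atTop (𝓝 0) := by
  have hlim : Tendsto (fun n : ℕ => ENNReal.ofReal θ ^ n * (w 0 s₀ * ENNReal.ofReal (h s₀)))
      atTop (𝓝 0) := by
    have := ENNReal.Tendsto.mul_const (b := w 0 s₀ * ENNReal.ofReal (h s₀))
      (ENNReal.tendsto_pow_atTop_nhds_zero_of_lt_one (r := ENNReal.ofReal θ)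
        (by rw [← ENNReal.ofReal_one]; exact (ENNReal.ofReal_lt_ofReal_iff one_pos).2 hθ1))
      (Or.inr (ENNReal.mul_ne_top hw₀ ENNReal.ofReal_ne_top))
    simpa using this
  refine tendsto_of_tendsto_of_tendsto_of_le_of_le tendsto_const_nhds hlim
    (fun n => zero_le) fun n => ?_
  refine le_trans ?_ (sum_pathSum_mul_le hp hρ (fun x => zero_le_one.trans (hh x)) hθ hw hle n)
  gcongr with x
  exact le_mul_of_one_le_right zero_le (by rw [← ENNReal.ofReal_one]; gcongr; exact hh x)

/-- First-passage decomposition: if `f` solves the equation of the weighted hitting probability of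
`s₁` and the weight of the paths that avoid `s₁` for `n` steps tends to zero, then the total weight
of the first passages to `s₁` is given by `f`. -/
lemma tsum_first_passage {w : ℕ → S → ℝ≥0∞} {r f : S → ℝ≥0∞} (s₁ : S)
    (hp : ∀ x y, 0 ≤ p x y) (hs : ∀ x, ∑ y, p x y = 1)
    (hw : ∀ k x, w (k + 1) x = if x = s₁ then 0 else r x) (hf1 : ∀ x, f x ≤ 1)
    (hf0 : f s₁ = 1) (hf : ∀ x, x ≠ s₁ → f x = r x * ∑ y, ENNReal.ofReal (p x y) * f y)
    (hlim : Tendsto (fun n => ∑ x, pathSum s₀ p w n x) atTop (𝓝 0)) :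
    ∑' n, ∑ x, pathSum s₀ p w n x * ENNReal.ofReal (p x s₁) =
      w 0 s₀ * ∑ y, ENNReal.ofReal (p s₀ y) * f y := by
  -- `b n` is the weight still to reach `s₁` after `n` avoiding steps. One step splits off the
  -- passages to `s₁`, so the series telescopes to `b 0` minus a vanishing remainder.
  set b : ℕ → ℝ≥0∞ := fun n =>
    ∑ x, pathSum s₀ p w n x * ∑ y, ENNReal.ofReal (p x y) * f y with hb
  have hstep : ∀ n, b n =
      ∑ x, pathSum s₀ p w n x * ENNReal.ofReal (p x s₁) + b (n + 1) := by
    intro n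
    have h1 : b n = ∑ y, (∑ x, pathSum s₀ p w n x * ENNReal.ofReal (p x y)) * f y := by
      simp_rw [hb, Finset.mul_sum, Finset.sum_mul]
      rw [Finset.sum_comm]
      simp_rw [mul_assoc]
    rw [h1, ← Finset.add_sum_erase _ _ (Finset.mem_univ s₁), hf0, mul_one]
    congr 1
    simp_rw [hb]
    rw [← Finset.add_sum_erase _ _ (Finset.mem_univ s₁)]
    simp only [pathSum, hw, if_true, mul_zero, zero_mul, zero_add]
    refine Finset.sum_congr rfl fun y hy => ?_
    rw [if_neg (Finset.ne_of_mem_erase hy), hf y (Finset.ne_of_mem_erase hy)]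
    ring
  have hsum : ∀ n, b 0 =
      ∑ k ∈ Finset.range n, ∑ x, pathSum s₀ p w k x * ENNReal.ofReal (p x s₁) + b n := by
    intro n
    induction n with
    | zero => simp
    | succ n ih => rw [ih, hstep n, Finset.sum_range_succ, add_assoc]
  have hb0 : b 0 = w 0 s₀ * ∑ y, ENNReal.ofReal (p s₀ y) * f y := by
    simp [hb, pathSum]
  have hblim : Tendsto b atTop (𝓝 0) := by
    refine tendsto_of_tendsto_of_tendsto_of_le_of_le tendsto_const_nhds hlim
      (fun n => zero_le) fun n => ?_
    simp only [hb]
    gcongr with x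
    refine mul_le_of_le_one_right zero_le ?_
    calc ∑ y, ENNReal.ofReal (p x y) * f y ≤ ∑ y, ENNReal.ofReal (p x y) * 1 := by
          gcongr with y; exact hf1 y
      _ = 1 := by
          simp_rw [mul_one]
          rw [← ENNReal.ofReal_sum_of_nonneg (fun y _ => hp x y), hs, ENNReal.ofReal_one]
  rw [← hb0]
  have h1 := (ENNReal.tendsto_nat_tsum
    fun n => ∑ x, pathSum s₀ p w n x * ENNReal.ofReal (p x s₁)).add hblim
  simp_rw [← hsum, add_zero] at h1
  exact tendsto_nhds_unique h1 tendsto_const_nhds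

end PathSum

/-! ### Transition probabilities of the quasi-diffusion -/

section Transition

variable {N : ℕ} {pt m : Fin (N + 1) → ℝ}

lemma transRate_nonneg (hm : ∀ i, 0 < m i) (i j : Fin (N + 1)) : 0 ≤ transRate pt m i j := by
  unfold transRate
  have := hm i
  split_ifs <;> positivity

lemma transRate_pos (hpt : StrictMono pt) (hm : ∀ i, 0 < m i) {i j : Fin (N + 1)}
    (hij : j.val = i.val + 1 ∨ i.val = j.val + 1) : 0 < transRate pt m i j := by
  rw [transRate, if_pos hij]
  have hne : pt j - pt i ≠ 0 := fun h => by
    have := congrArg Fin.val (hpt.injective (sub_eq_zero.1 h))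
    omega
  exact one_div_pos.2 (mul_pos (hm i) (abs_pos.2 hne))

lemma holdingRate_pos (hN : 1 ≤ N) (hpt : StrictMono pt) (hm : ∀ i, 0 < m i) (i : Fin (N + 1)) :
    0 < holdingRate pt m i := by
  obtain ⟨j, hj⟩ : ∃ j : Fin (N + 1), j.val = i.val + 1 ∨ i.val = j.val + 1 := by
    by_cases hi : i.val = 0
    · exact ⟨⟨1, by omega⟩, Or.inl (by simp [hi])⟩
    · exact ⟨⟨i.val - 1, by omega⟩, Or.inr (by simp only; omega)⟩
  exact Finset.sum_pos' (fun j _ => transRate_nonneg hm i j)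
    ⟨j, Finset.mem_univ j, transRate_pos hpt hm hj⟩

lemma jumpProb_nonneg (hm : ∀ i, 0 < m i) (i j : Fin (N + 1)) : 0 ≤ jumpProb pt m i j :=
  div_nonneg (transRate_nonneg hm i j) (Finset.sum_nonneg fun j _ => transRate_nonneg hm i j)

lemma sum_jumpProb (hN : 1 ≤ N) (hpt : StrictMono pt) (hm : ∀ i, 0 < m i) (i : Fin (N + 1)) :
    ∑ j, jumpProb pt m i j = 1 := by
  simp_rw [jumpProb]
  rw [← Finset.sum_div]
  exact div_self (holdingRate_pos hN hpt hm i).ne'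

lemma jumpProb_eq_zero {i j : Fin (N + 1)} (hij : ¬(j.val = i.val + 1 ∨ i.val = j.val + 1)) :
    jumpProb pt m i j = 0 := by
  rw [jumpProb, transRate, if_neg hij, zero_div]

lemma sum_jumpProb_mul_zero (hN : 1 ≤ N) (hpt : StrictMono pt) (hm : ∀ i, 0 < m i) (g : ℕ → ℝ)
    {i : Fin (N + 1)} (hi : i.val = 0) : ∑ j, jumpProb pt m i j * g j = g 1 := by
  rw [← one_mul (g 1), ← sum_jumpProb hN hpt hm i, Finset.sum_mul]
  refine Finset.sum_congr rfl fun j _ => ?_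
  by_cases hj : j.val = 1
  · rw [hj]
  · rw [jumpProb_eq_zero (by omega), zero_mul, zero_mul]

lemma sum_jumpProb_mul_last (hN : 1 ≤ N) (hpt : StrictMono pt) (hm : ∀ i, 0 < m i) (g : ℕ → ℝ)
    {i : Fin (N + 1)} (hi : i.val = N) : ∑ j, jumpProb pt m i j * g j = g (N - 1) := by
  rw [← one_mul (g (N - 1)), ← sum_jumpProb hN hpt hm i, Finset.sum_mul]
  refine Finset.sum_congr rfl fun j _ => ?_
  by_cases hj : j.val = N - 1
  · rw [hj]
  · rw [jumpProb_eq_zero (by omega), zero_mul, zero_mul]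

lemma sum_jumpProb_mul_interior (hN : 1 ≤ N) (hpt : StrictMono pt) (hm : ∀ i, 0 < m i)
    (hp : ∀ i j : Fin (N + 1), 0 < i.val → j.val = i.val + 1 → jumpProb pt m i j = 1 / 2)
    (g : ℕ → ℝ) {i : Fin (N + 1)} (h0 : 0 < i.val) (hi : i.val < N) :
    ∑ j, jumpProb pt m i j * g j = (g (i.val - 1) + g (i.val + 1)) / 2 := by
  have h1 : ∀ j : Fin (N + 1), jumpProb pt m i j * g j = jumpProb pt m i j * g (i.val - 1) +
      if j = ⟨i.val + 1, by omega⟩ then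
        jumpProb pt m i j * (g (i.val + 1) - g (i.val - 1)) else 0 := by
    intro j
    split_ifs with hj
    · subst hj
      ring
    · have hj' : j.val ≠ i.val + 1 := fun h => hj (Fin.ext h)
      by_cases hj1 : j.val = i.val - 1
      · rw [hj1, add_zero]
      · rw [jumpProb_eq_zero (by omega), zero_mul, zero_mul, add_zero]
  simp_rw [h1]
  rw [Finset.sum_add_distrib, ← Finset.sum_mul, sum_jumpProb hN hpt hm, Finset.sum_ite_eq',
    if_pos (Finset.mem_univ _), hp i _ h0 rfl]
  ring

/-- A strictly superharmonic function for the chain that is killed at the left end point with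
positive probability. -/
lemma exists_superharmonic (hN : 1 ≤ N) (hpt : StrictMono pt) (hm : ∀ i, 0 < m i)
    (hp : ∀ i j : Fin (N + 1), 0 < i.val → j.val = i.val + 1 → jumpProb pt m i j = 1 / 2)
    {c : ℝ} (hc0 : 0 < c) (hc1 : c < 1) :
    ∃ (h : Fin (N + 1) → ℝ) (θ : ℝ), (∀ x, 1 ≤ h x) ∧ 0 ≤ θ ∧ θ < 1 ∧
      ∀ x, ∑ y, jumpProb pt m x y * ((if y = 0 then c else 1) * h y) ≤ θ * h x := by
  have hN' : (1 : ℝ) ≤ N := by exact_mod_cast hN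
  -- With this `ε`, `h 0 = 1 / c`, so the weighted function `(if y = 0 then c else 1) * h y` is the
  -- concave parabola `g`. Averaging `g` over neighbours loses `ε` at every interior point, and
  -- stepping back from its vertex `N` also loses `ε`. At `0` one has `g 1 = h 0 - ε`.
  obtain ⟨ε, hε, hεc⟩ : ∃ ε : ℝ, 0 < ε ∧ c * (1 + 2 * N * ε) = 1 := by
    refine ⟨(1 / c - 1) / (2 * N), ?_, ?_⟩
    · have : 1 < 1 / c := (one_lt_div hc0).2 hc1
      exact div_pos (by linarith) (by linarith)
    · field_simp
      ring
  set g : ℕ → ℝ := fun k => 1 + ε * (k * (2 * N - k)) with hg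
  set h : Fin (N + 1) → ℝ := fun x => if x = 0 then 1 + 2 * N * ε else g x with hh
  have hgh : ∀ y : Fin (N + 1), (if y = 0 then c else 1) * h y = g y := by
    intro y
    by_cases hy : y = 0
    · subst hy
      simp [hh, hg, hεc]
    · simp [hh, hy]
  have hh1 : ∀ x, 1 ≤ h x := by
    intro x
    have hx : (x.val : ℝ) ≤ N := by exact_mod_cast Nat.lt_succ_iff.1 x.2
    simp only [hh, hg]
    split_ifs
    · nlinarith [mul_pos (zero_lt_one.trans_le hN') hε]
    · have : 0 ≤ (x.val : ℝ) * (2 * N - x.val) :=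
        mul_nonneg (Nat.cast_nonneg _) (by linarith)
      nlinarith [mul_nonneg hε.le this]
  have hlt : ∀ x, ∑ y, jumpProb pt m x y * ((if y = 0 then c else 1) * h y) < h x := by
    intro x
    simp_rw [hgh]
    by_cases hx0 : x.val = 0
    · rw [sum_jumpProb_mul_zero hN hpt hm g hx0]
      have : x = 0 := Fin.ext hx0
      simp only [hh, hg, this, if_true]
      push_cast
      nlinarith
    have hx0' : x ≠ 0 := fun h => hx0 (by simp [h])
    have hhx : h x = g x := by simp [hh, hx0']
    rw [hhx]
    by_cases hxN : x.val = N
    · rw [sum_jumpProb_mul_last hN hpt hm g hxN, hxN]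
      simp only [hg]
      rw [Nat.cast_sub hN]
      push_cast
      nlinarith
    · rw [sum_jumpProb_mul_interior hN hpt hm hp g (Nat.pos_of_ne_zero hx0) (by omega)]
      simp only [hg]
      rw [Nat.cast_sub (by omega : 1 ≤ x.val)]
      push_cast
      nlinarith
  -- On a finite set the strict inequalities become uniform: `θ` is the largest ratio.
  obtain ⟨x₀, -, hx₀⟩ := Finset.exists_max_image Finset.univ
    (fun x => (∑ y, jumpProb pt m x y * ((if y = 0 then c else 1) * h y)) / h x)
    Finset.univ_nonempty
  have hpos : ∀ x, 0 < h x := fun x => zero_lt_one.trans_le (hh1 x)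
  refine ⟨h, (∑ y, jumpProb pt m x₀ y * ((if y = 0 then c else 1) * h y)) / h x₀, hh1, ?_, ?_,
    fun x => ?_⟩
  · refine div_nonneg (Finset.sum_nonneg fun y _ => mul_nonneg (jumpProb_nonneg hm _ _) ?_)
      (hpos _).le
    have := hpos y
    split_ifs <;> positivity
  · exact (div_lt_one (hpos _)).2 (hlt x₀)
  · exact (div_le_iff₀ (hpos x)).1 (hx₀ x (Finset.mem_univ x))

lemma tendsto_sum_pathSum_jumpProb (hN : 1 ≤ N) (hpt : StrictMono pt) (hm : ∀ i, 0 < m i)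
    (hp : ∀ i j : Fin (N + 1), 0 < i.val → j.val = i.val + 1 → jumpProb pt m i j = 1 / 2)
    {w : ℕ → Fin (N + 1) → ℝ≥0∞} {c : ℝ} (hc0 : 0 < c) (hc1 : c < 1) (hw₀ : w 0 0 ≠ ∞)
    (hw : ∀ k x, w (k + 1) x ≤ if x = 0 then ENNReal.ofReal c else 1) :
    Tendsto (fun n => ∑ x, pathSum 0 (jumpProb pt m) w n x) atTop (𝓝 0) := by
  obtain ⟨h, θ, hh, hθ0, hθ1, hle⟩ := exists_superharmonic hN hpt hm hp hc0 hc1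
  refine tendsto_sum_pathSum (jumpProb_nonneg hm) (fun x => ?_) hh hθ0 hθ1 hw₀
    (fun k x => ?_) hle
  · split_ifs <;> positivity
  · refine (hw k x).trans (le_of_eq ?_)
    split_ifs <;> simp

end Transition

/-! ### The continued fraction -/

/-- With `φ k = f k / f (k - 1)`, the interior equation reads `φ k * (2 * (z + a k) - a k * φ (k +
1)) = a k`. Thus `a k * φ (k + 1)` is the tail of the fraction from term `k + 1` on, and `f` is
recovered as the product of the `φ`. -/
lemma exists_hitting_transform {N : ℕ} (hN : 1 ≤ N) {a : ℕ → ℝ} (ha : ∀ k ≤ N, 0 < a k) {z : ℝ}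
    (hz : 0 ≤ z) :
    ∃ f : ℕ → ℝ, f 0 = 1 ∧
      f 1 = minusFrac (fun k => if k = 1 then a 1 else a (k - 1) * a k)
        (fun k => if k = N then z + a N else 2 * (z + a k)) 1 N ∧
      (∀ k ≤ N, 0 ≤ f k ∧ f k ≤ 1) ∧
      (∀ k, 0 < k → k < N → f k = a k / (z + a k) * ((f (k - 1) + f (k + 1)) / 2)) ∧
      f N = a N / (z + a N) * f (N - 1) := by
  set c : ℕ → ℝ := fun k => if k = 1 then a 1 else a (k - 1) * a k with hc
  set d : ℕ → ℝ := fun k => if k = N then z + a N else 2 * (z + a k) with hd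
  set M : ℕ → ℝ := fun k => minusFrac c d k (N + 1 - k) with hM
  have hMN : M (N + 1) = 0 := by simp [hM, minusFrac]
  have hMrec : ∀ k, k ≤ N → M k = c k / (d k - M (k + 1)) := by
    intro k hk
    simp only [hM]
    rw [show N + 1 - k = (N + 1 - (k + 1)) + 1 by omega, minusFrac]
  -- The bound `M (k + 1) ≤ a k` keeps every denominator at least `a k > 0`; it propagates downwards
  -- from the empty tail `M (N + 1) = 0`.
  have hden : ∀ k, 1 ≤ k → k ≤ N → M (k + 1) ≤ a k → a k ≤ d k - M (k + 1) := by
    intro k hk hkN hle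
    by_cases h : k = N
    · subst h
      rw [hMN]
      simp [hd, hz]
    · simp only [hd, h, if_false]
      linarith
  have hMb : ∀ n k, k + n = N + 1 → 2 ≤ k → 0 ≤ M k ∧ M k ≤ a (k - 1) := by
    intro n
    induction n with
    | zero =>
      intro k hk _
      obtain rfl : k = N + 1 := by omega
      rw [hMN]
      exact ⟨le_rfl, (ha _ (by omega)).le⟩
    | succ n ih =>
      intro k hk hk2
      have h1 := ih (k + 1) (by omega) (by omega)
      have hak := ha k (by omega)
      have hak' := ha (k - 1) (by omega)
      have h2 := hden k (by omega) (by omega) h1.2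
      have hck : c k = a (k - 1) * a k := if_neg (by omega)
      rw [hMrec k (by omega), hck]
      have hpos : 0 < d k - M (k + 1) := by linarith
      refine ⟨by positivity, ?_⟩
      rw [div_le_iff₀ hpos]
      gcongr
  have hMb' : ∀ k, 1 ≤ k → k ≤ N → 0 ≤ M (k + 1) ∧ M (k + 1) ≤ a k := fun k h1 h2 =>
    hMb (N - k) (k + 1) (by omega) (by omega)
  -- The numerator is `a k` and not `c k`: the two agree at `k = 1`, and otherwise `c k` has the
  -- extra factor `a (k - 1)`.
  set φ : ℕ → ℝ := fun k => a k / (d k - M (k + 1)) with hφ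
  have hφ1 : φ 1 = M 1 := by rw [hMrec 1 hN]; simp [hφ, hc]
  have hφM : ∀ k, 1 ≤ k → k < N → M (k + 1) = a k * φ (k + 1) := by
    intro k hk hkN
    rw [hMrec (k + 1) (by omega)]
    have : c (k + 1) = a k * a (k + 1) := by
      simp only [hc]
      rw [if_neg (by omega), Nat.add_sub_cancel]
    rw [this, hφ, mul_div_assoc]
  have hφb : ∀ k, 1 ≤ k → k ≤ N → 0 ≤ φ k ∧ φ k ≤ 1 := by
    intro k hk hkN
    have h1 := hden k hk hkN (hMb' k hk hkN).2
    have hak := ha k hkN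
    have hpos : 0 < d k - M (k + 1) := by linarith
    exact ⟨by positivity, (div_le_one hpos).2 h1⟩
  refine ⟨fun k => ∏ j ∈ Finset.range k, φ (j + 1), by simp, ?_, fun k hk => ⟨?_, ?_⟩, ?_, ?_⟩
  · simp [hφ1, hM]
  · refine Finset.prod_nonneg fun j hj => (hφb _ (by omega) ?_).1
    have := Finset.mem_range.1 hj
    omega
  · refine Finset.prod_le_one (fun j hj => (hφb _ (by omega) ?_).1)
      (fun j hj => (hφb _ (by omega) ?_).2) <;>
    · have := Finset.mem_range.1 hj
      omega
  · intro k hk hkN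
    obtain ⟨k, rfl⟩ := Nat.exists_eq_succ_of_ne_zero hk.ne'
    simp only [Nat.succ_eq_add_one, Nat.add_sub_cancel, Finset.prod_range_succ]
    have hak := ha (k + 1) hkN.le
    have h1 := hden (k + 1) (by omega) hkN.le (hMb' (k + 1) (by omega) hkN.le).2
    have h2 : φ (k + 1) * (2 * (z + a (k + 1)) - a (k + 1) * φ (k + 2)) = a (k + 1) := by
      rw [← hφM (k + 1) (by omega) hkN]
      have hdk : d (k + 1) = 2 * (z + a (k + 1)) := if_neg hkN.ne
      rw [hφ, ← hdk]
      exact div_mul_cancel₀ _ (by linarith)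
    rw [div_mul_eq_mul_div, eq_div_iff (by linarith : z + a (k + 1) ≠ 0)]
    linear_combination (∏ j ∈ Finset.range k, φ (j + 1)) / 2 * h2
  · obtain ⟨K, rfl⟩ := Nat.exists_eq_succ_of_ne_zero (by omega : N ≠ 0)
    simp only [Nat.succ_eq_add_one, Nat.add_sub_cancel, Finset.prod_range_succ]
    have : φ (K + 1) = a (K + 1) / (z + a (K + 1)) := by
      simp only [hφ]
      rw [hMN]
      simp [hd]
    rw [this, mul_comm]

end QuasiDiffusion

namespace QuasiDiffusion

/-! ### The excursion law -/

section Excursion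

variable {Ω : Type*} [MeasurableSpace Ω] {P : Measure Ω} [IsProbabilityMeasure P] {N : ℕ}
  {pt m : Fin (N + 1) → ℝ} {Y : ℕ → Ω → Fin (N + 1)} {T : ℕ → Ω → ℝ≥0}

/-- The expectation of `exp (-timeAt)` is a path sum in which each visit to `0` costs a factor `a /
(1 + a) < 1`, with `a` the rate there, so it tends to zero. By Markov's inequality the total time at
`0` is a.s. not bounded by `t`. -/
lemma ae_exists_lt_timeAt (hN : 1 ≤ N) (hpt : StrictMono pt) (hm : ∀ i, 0 < m i)
    (hp : ∀ i j : Fin (N + 1), 0 < i.val → j.val = i.val + 1 → jumpProb pt m i j = 1 / 2)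
    (h : IsJumpHold P 0 (jumpProb pt m) (holdingRate pt m) Y T) (t : ℝ≥0) :
    ∀ᵐ ω ∂P, ∃ n, t < timeAt (fun k => pt (Y k ω)) (fun k => T k ω) (pt 0) n := by
  set φ : ℕ → Fin (N + 1) → ℝ → ℝ≥0∞ := fun _ x s =>
    if x = 0 then ENNReal.ofReal (Real.exp (-(1 * s))) else 1 with hφ
  have hφm : ∀ k x, Measurable (φ k x) := by
    intro k x
    simp only [hφ]
    split_ifs <;> fun_prop
  have ha0 : 0 < holdingRate pt m 0 := h.rate_pos 0
  have hlim : Tendsto (fun n => ∫⁻ ω, ∏ k ∈ Finset.range (n + 1), φ k (Y k ω) (T k ω) ∂P)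
      atTop (𝓝 0) := by
    simp_rw [h.lintegral_prod φ hφm]
    have hint : ∀ x, ∫⁻ s, φ 0 x s ∂(expMeasure (holdingRate pt m x)) =
        if x = 0 then ENNReal.ofReal (holdingRate pt m 0 / (1 + holdingRate pt m 0)) else 1 := by
      intro x
      have := isProbabilityMeasure_expMeasure (h.rate_pos x)
      simp only [hφ]
      split_ifs with hx
      · rw [hx, lintegral_exp_neg_mul_expMeasure ha0 zero_le_one]
      · simp
    refine tendsto_sum_pathSum_jumpProb hN hpt hm hp
      (c := holdingRate pt m 0 / (1 + holdingRate pt m 0)) (by positivity)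
      ((div_lt_one (by positivity)).2 (by linarith)) ?_ (fun k x => (hint x).le)
    rw [hint, if_pos rfl]
    exact ENNReal.ofReal_ne_top
  have hprod : ∀ n ω, ∏ k ∈ Finset.range n, φ k (Y k ω) (T k ω) = ENNReal.ofReal (Real.exp
      (-(timeAt (fun k => pt (Y k ω)) (fun k => T k ω) (pt 0) n : ℝ))) := by
    intro n ω
    induction n with
    | zero => simp [timeAt]
    | succ n ih =>
      rw [Finset.prod_range_succ, ih, timeAt, timeAt, Finset.sum_range_succ]
      simp only [hφ, hpt.injective.eq_iff]
      split_ifs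
      · rw [← ENNReal.ofReal_mul (Real.exp_pos _).le, ← Real.exp_add]
        push_cast
        ring_nf
      · simp
  have hB : ∀ n, ENNReal.ofReal (Real.exp (-(t : ℝ))) *
      P {ω | ¬ ∃ n, t < timeAt (fun k => pt (Y k ω)) (fun k => T k ω) (pt 0) n} ≤
      ∫⁻ ω, ∏ k ∈ Finset.range (n + 1), φ k (Y k ω) (T k ω) ∂P := by
    intro n
    have hmeas : Measurable fun ω => ∏ k ∈ Finset.range (n + 1), φ k (Y k ω) (T k ω) := by
      refine Finset.measurable_prod _ fun k _ => ?_
      have h2 : Measurable fun q : Fin (N + 1) × ℝ => φ k q.1 q.2 :=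
        measurable_from_prod_countable_right fun x => hφm k x
      exact h2.comp ((h.measurable_chain k).prodMk (h.measurable_time k).coe_nnreal_real)
    refine le_trans ?_ (mul_meas_ge_le_lintegral hmeas (ENNReal.ofReal (Real.exp (-(t : ℝ)))))
    refine mul_le_mul_right (measure_mono fun ω hω => ?_) _
    simp only [Set.mem_ofPred_eq, not_exists, not_lt] at hω ⊢
    rw [hprod]
    gcongr
    exact_mod_cast hω (n + 1)
  have h0 := ge_of_tendsto' hlim hB
  rw [nonpos_iff_eq_zero, mul_eq_zero, ENNReal.ofReal_eq_zero, ← not_lt] at h0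
  exact ae_iff.2 (h0.resolve_left fun h => h (Real.exp_pos _))

/-- The event that the first return to the left end point takes place in step `n + 1`, while the
first sojourn there ends, and the second one does not end, before the local time exceeds `t`. -/
def returnEvent (Y : ℕ → Ω → Fin (N + 1)) (T : ℕ → Ω → ℝ≥0) (t : ℝ≥0) (n : ℕ) : Set Ω :=
  {ω | (∀ k < n, Y (k + 1) ω ≠ 0) ∧ Y (n + 1) ω = 0} ∩
    {ω | T 0 ω ≤ t ∧ t < T 0 ω + T (n + 1) ω}

/-- The weights of the paths that avoid the left end point after the start, where each holding time
`s` contributes the expectation of `exp (-(z * s))`. -/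
noncomputable def avoidWeight (a : Fin (N + 1) → ℝ) (z : ℝ) : ℕ → Fin (N + 1) → ℝ≥0∞
  | 0, _ => 1
  | _ + 1, x => if x = 0 then 0 else ENNReal.ofReal (a x / (z + a x))

/-- The probability that, of two independent exponential times of rate `r`, the first one is at most
`t` and their sum exceeds `t`. -/
noncomputable def secondSojournProb (r : ℝ) (t : ℝ≥0) : ℝ≥0∞ :=
  ((expMeasure r).prod (expMeasure r)) {q : ℝ × ℝ | q.1 ≤ t ∧ t < q.1 + q.2}

lemma secondSojournProb_ne_zero {r : ℝ} (hr : 0 < r) {t : ℝ≥0} (ht : 0 < t) :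
    secondSojournProb r t ≠ 0 := by
  have := isProbabilityMeasure_expMeasure hr
  -- If the first time lies in `(0, t]` and the second exceeds `t`, the condition holds; this
  -- rectangle has positive mass because `t > 0`.
  have hsub : Set.Ioc 0 (t : ℝ) ×ˢ Set.Ioi (t : ℝ) ⊆ {q : ℝ × ℝ | q.1 ≤ t ∧ t < q.1 + q.2} := by
    rintro ⟨x, y⟩ ⟨⟨h1, h2⟩, h3⟩
    refine ⟨h2, ?_⟩
    simp only [Set.mem_Ioi] at h1 h3 ⊢
    linarith
  refine ne_of_gt (lt_of_lt_of_le ?_ (measure_mono hsub))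
  have ht' : (0 : ℝ) < t := by exact_mod_cast ht
  rw [Measure.prod_prod, ← Set.Ioi_sdiff_Ioi, measure_sdiff (Set.Ioi_subset_Ioi ht'.le)
    measurableSet_Ioi.nullMeasurableSet (measure_ne_top _ _), expMeasure_Ioi hr, expMeasure_Ioi hr,
    max_self, max_eq_left ht'.le]
  refine ENNReal.mul_pos ?_ ?_
  · refine (tsub_pos_of_lt ?_).ne'
    rw [ENNReal.ofReal_lt_ofReal_iff (Real.exp_pos _)]
    gcongr
  · exact (ENNReal.ofReal_pos.2 (Real.exp_pos _)).ne'

lemma secondSojournProb_ne_top {r : ℝ} (hr : 0 < r) (t : ℝ≥0) : secondSojournProb r t ≠ ∞ := by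
  have := isProbabilityMeasure_expMeasure hr
  exact measure_ne_top _ _

lemma measurableSet_returnEvent (hY : ∀ n, Measurable (Y n)) (hT : ∀ n, Measurable (T n))
    (t : ℝ≥0) (n : ℕ) : MeasurableSet (returnEvent Y T t n) := by
  refine (MeasurableSet.inter ?_ (hY (n + 1) (measurableSet_singleton 0))).inter
    ((measurableSet_le (hT 0) measurable_const).inter
      (measurableSet_lt (f := fun _ => t) (g := fun ω => T 0 ω + T (n + 1) ω) measurable_const
        ((hT 0).add (hT (n + 1)))))
  have : {ω | ∀ k < n, Y (k + 1) ω ≠ 0} = ⋂ k, ⋂ (_ : k < n), (Y (k + 1) ⁻¹' {0})ᶜ := by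
    ext ω
    simp
  change MeasurableSet {ω | ∀ k < n, Y (k + 1) ω ≠ 0}
  rw [this]
  exact MeasurableSet.iInter fun k => MeasurableSet.iInter fun _ =>
    (hY (k + 1) (measurableSet_singleton 0)).compl

omit [MeasurableSpace Ω] in
lemma pairwise_disjoint_returnEvent (Y : ℕ → Ω → Fin (N + 1)) (T : ℕ → Ω → ℝ≥0) (t : ℝ≥0) :
    Pairwise (Function.onFun Disjoint (returnEvent Y T t)) := by
  intro i j hij
  refine Set.disjoint_left.2 fun ω hi hj => ?_
  rcases lt_or_gt_of_ne hij with hlt | hlt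
  · exact hj.1.1 i hlt hi.1.2
  · exact hi.1.1 j hlt hj.1.2

/-- The time condition couples `T 0` and `T (n + 1)`, so it is not a product. The factorization is
proved for rectangles in these two times and extended by uniqueness of product measures, with the
excursion weight `R` as a density. -/
lemma setLIntegral_returnEvent (h : IsJumpHold P 0 (jumpProb pt m) (holdingRate pt m) Y T)
    (t : ℝ≥0) {z : ℝ} (hz : 0 ≤ z) (n : ℕ) :
    ∫⁻ ω in returnEvent Y T t n,
        ENNReal.ofReal (Real.exp (-(z * ∑ k ∈ Finset.range n, (T (k + 1) ω : ℝ)))) ∂P =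
      (∑ x, pathSum 0 (jumpProb pt m) (avoidWeight (holdingRate pt m) z) n x *
        ENNReal.ofReal (jumpProb pt m x 0)) * secondSojournProb (holdingRate pt m 0) t := by
  have hprob : ∀ x, IsProbabilityMeasure (expMeasure (holdingRate pt m x)) := fun x =>
    isProbabilityMeasure_expMeasure (h.rate_pos x)
  set ψ : Fin (N + 1) → ℝ → ℝ≥0∞ := fun x s =>
    if x = 0 then 0 else ENNReal.ofReal (Real.exp (-(z * s))) with hψ
  have hψm : ∀ x, Measurable (ψ x) := by
    intro x
    simp only [hψ]
    split_ifs <;> fun_prop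
  have hψm2 : Measurable fun q : Fin (N + 1) × ℝ => ψ q.1 q.2 :=
    measurable_from_prod_countable_right hψm
  set R : Ω → ℝ≥0∞ := fun ω => (∏ k ∈ Finset.range n, ψ (Y (k + 1) ω) (T (k + 1) ω)) *
    if Y (n + 1) ω = 0 then 1 else 0 with hR
  have hRm : Measurable R := by
    refine (Finset.measurable_prod _ fun k _ => hψm2.comp
      ((h.measurable_chain _).prodMk (h.measurable_time _).coe_nnreal_real)).mul ?_
    exact Measurable.ite (h.measurable_chain _ (measurableSet_singleton 0)) measurable_const
      measurable_const
  have hR1 : ∀ ω, R ω ≤ 1 := by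
    intro ω
    refine mul_le_one' (Finset.prod_le_one' fun k _ => ?_) (by split_ifs <;> simp)
    simp only [hψ]
    split_ifs
    · exact zero_le
    · rw [← ENNReal.ofReal_one]
      gcongr
      rw [Real.exp_le_one_iff]
      have := mul_nonneg hz (T (k + 1) ω).coe_nonneg
      linarith
  have hRE : ∀ ω, R ω = Set.indicator {ω | (∀ k < n, Y (k + 1) ω ≠ 0) ∧ Y (n + 1) ω = 0}
      (fun ω => ENNReal.ofReal (Real.exp (-(z * ∑ k ∈ Finset.range n, (T (k + 1) ω : ℝ))))) ω := by
    intro ω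
    by_cases hω : ω ∈ {ω | (∀ k < n, Y (k + 1) ω ≠ 0) ∧ Y (n + 1) ω = 0}
    · rw [Set.indicator_of_mem hω, hR]
      simp only [hω.2, if_true, mul_one]
      rw [Finset.mul_sum, ← Finset.sum_neg_distrib, Real.exp_sum,
        ENNReal.ofReal_prod_of_nonneg (fun _ _ => (Real.exp_pos _).le)]
      refine Finset.prod_congr rfl fun k hk => ?_
      simp only [hψ]
      rw [if_neg (hω.1 k (Finset.mem_range.1 hk))]
    · rw [Set.indicator_of_notMem hω, hR]
      by_cases h0 : Y (n + 1) ω = 0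
      · have : ∃ k < n, Y (k + 1) ω = 0 := by
          by_contra hc
          push Not at hc
          exact hω ⟨hc, h0⟩
        obtain ⟨k, hk, hk0⟩ := this
        simp only
        rw [Finset.prod_eq_zero (Finset.mem_range.2 hk), zero_mul]
        simp [hψ, hk0]
      · simp [h0]
  set G : ℝ≥0∞ := ∑ x, pathSum 0 (jumpProb pt m) (avoidWeight (holdingRate pt m) z) n x *
        ENNReal.ofReal (jumpProb pt m x 0) with hG
  set E₀ := expMeasure (holdingRate pt m 0) with hE₀
  have hbox : ∀ B₁ B₂ : Set ℝ, MeasurableSet B₁ → MeasurableSet B₂ →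
      ∫⁻ ω, B₁.indicator 1 (T 0 ω : ℝ) * (R ω * B₂.indicator 1 (T (n + 1) ω : ℝ)) ∂P =
        G * E₀ B₁ * E₀ B₂ := by
    intro B₁ B₂ hB₁ hB₂
    set φ : ℕ → Fin (N + 1) → ℝ → ℝ≥0∞ := fun k x s =>
      if k = 0 then B₁.indicator 1 s else
        if k = n + 1 then (if x = 0 then B₂.indicator 1 s else 0) else ψ x s with hφ
    have hφm : ∀ k x, Measurable (φ k x) := by
      intro k x
      simp only [hφ]
      split_ifs
      · exact measurable_one.indicator hB₁
      · exact measurable_one.indicator hB₂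
      · exact measurable_const
      · exact hψm x
    have h1 : ∀ ω, B₁.indicator 1 (T 0 ω : ℝ) * (R ω * B₂.indicator 1 (T (n + 1) ω : ℝ)) =
        ∏ k ∈ Finset.range (n + 1 + 1), φ k (Y k ω) (T k ω) := by
      intro ω
      rw [Finset.prod_range_succ, Finset.prod_range_succ']
      have : ∏ k ∈ Finset.range n, φ (k + 1) (Y (k + 1) ω) (T (k + 1) ω) =
          ∏ k ∈ Finset.range n, ψ (Y (k + 1) ω) (T (k + 1) ω) := by
        refine Finset.prod_congr rfl fun k hk => ?_
        have := Finset.mem_range.1 hk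
        simp only [hφ]
        rw [if_neg (by omega), if_neg (by omega)]
      rw [this]
      simp only [hφ, hR, if_true, Nat.succ_ne_zero, if_false]
      split_ifs <;> ring
    simp_rw [h1]
    rw [h.lintegral_prod φ hφm]
    simp only [pathSum]
    have hlast : ∀ y, ∫⁻ s, φ (n + 1) y s ∂(expMeasure (holdingRate pt m y)) =
        if y = 0 then E₀ B₂ else 0 := by
      intro y
      simp only [hφ, Nat.succ_ne_zero, if_false, if_true]
      split_ifs with hy
      · rw [lintegral_indicator_one hB₂, hy]
      · simp
    simp_rw [hlast, mul_ite, mul_zero]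
    rw [Finset.sum_ite_eq' Finset.univ, if_pos (Finset.mem_univ _)]
    have hpath : ∀ x, pathSum 0 (jumpProb pt m)
        (fun k x => ∫⁻ s, φ k x s ∂(expMeasure (holdingRate pt m x))) n x =
        E₀ B₁ * pathSum 0 (jumpProb pt m) (avoidWeight (holdingRate pt m) z) n x := by
      refine fun x => pathSum_eq_const_mul ?_ (fun k hk => funext fun x => ?_) x
      · simp only [hφ, if_true]
        rw [lintegral_indicator_one hB₁, avoidWeight, mul_one]
      · simp only [hφ, Nat.succ_ne_zero, if_false, avoidWeight]
        have hk' : ¬ k + 1 = n + 1 := by omega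
        simp only [hk', if_false, hψ]
        split_ifs
        · simp
        · exact lintegral_exp_neg_mul_expMeasure (h.rate_pos x) hz
    simp_rw [hpath, mul_assoc, ← Finset.mul_sum]
    rw [← hG]
    ring
  -- Finiteness of `G` makes `G • E₀` a finite measure, to which the uniqueness of product measures
  -- applies.
  have hGtop : G ≠ ∞ := by
    have := hbox Set.univ Set.univ MeasurableSet.univ MeasurableSet.univ
    simp only [Set.indicator_univ, Pi.one_apply, one_mul, mul_one, measure_univ] at this
    rw [← this]
    refine ne_of_lt (lt_of_le_of_lt (lintegral_mono hR1) ?_)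
    simp
  have hmT : Measurable fun ω => ((T 0 ω : ℝ), (T (n + 1) ω : ℝ)) :=
    (h.measurable_time 0).coe_nnreal_real.prodMk (h.measurable_time (n + 1)).coe_nnreal_real
  have hfin : IsFiniteMeasure (G • E₀) := ⟨by
    rw [Measure.smul_apply, measure_univ, smul_eq_mul, mul_one]
    exact hGtop.lt_top⟩
  have hlaw : (G • E₀).prod E₀ =
      (P.withDensity R).map fun ω => ((T 0 ω : ℝ), (T (n + 1) ω : ℝ)) := by
    refine Measure.prod_eq fun B₁ B₂ hB₁ hB₂ => ?_
    have hpre := hmT (hB₁.prod hB₂)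
    rw [Measure.map_apply hmT (hB₁.prod hB₂), withDensity_apply _ hpre,
      ← lintegral_indicator hpre, Measure.smul_apply, smul_eq_mul, ← hbox B₁ B₂ hB₁ hB₂]
    refine lintegral_congr fun ω => ?_
    by_cases h1 : (T 0 ω : ℝ) ∈ B₁ <;> by_cases h2 : (T (n + 1) ω : ℝ) ∈ B₂ <;>
      simp [Set.indicator, h1, h2]
  have hQ : MeasurableSet {q : ℝ × ℝ | q.1 ≤ t ∧ t < q.1 + q.2} :=
    (measurableSet_le measurable_fst measurable_const).inter
      (measurableSet_lt measurable_const (measurable_fst.add measurable_snd))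
  have hQpre : (fun ω => ((T 0 ω : ℝ), (T (n + 1) ω : ℝ))) ⁻¹'
      {q : ℝ × ℝ | q.1 ≤ t ∧ t < q.1 + q.2} = {ω | T 0 ω ≤ t ∧ t < T 0 ω + T (n + 1) ω} := by
    ext ω
    simp only [Set.mem_preimage, Set.mem_ofPred_eq]
    norm_cast
  have hEm : MeasurableSet {ω | (∀ k < n, Y (k + 1) ω ≠ 0) ∧ Y (n + 1) ω = 0} := by
    -- With all holding times and `t` equal to `1`, the time condition is always true and only the
    -- chain condition remains.
    have := measurableSet_returnEvent (T := fun _ _ => 1) h.measurable_chain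
      (fun _ => measurable_const) 1 n
    simpa [returnEvent] using this
  rw [returnEvent, ← Measure.restrict_restrict hEm, ← lintegral_indicator hEm]
  simp_rw [← hRE]
  rw [← hQpre, ← withDensity_apply _ (hmT hQ), ← Measure.map_apply hmT hQ, ← hlaw,
    Measure.prod_smul_left, Measure.smul_apply, smul_eq_mul, secondSojournProb]

/-- Any solution `f` with values in `[0, 1]` is allowed: `f = 1` at `z = 0` yields the probability
of the conditioning event, the continued fraction the transform. -/
lemma tsum_setLIntegral_returnEvent (hN : 1 ≤ N) (hpt : StrictMono pt) (hm : ∀ i, 0 < m i)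
    (hp : ∀ i j : Fin (N + 1), 0 < i.val → j.val = i.val + 1 → jumpProb pt m i j = 1 / 2)
    (h : IsJumpHold P 0 (jumpProb pt m) (holdingRate pt m) Y T) (t : ℝ≥0) {z : ℝ} (hz : 0 ≤ z)
    {f : ℕ → ℝ} (hf0 : f 0 = 1) (hfb : ∀ k ≤ N, 0 ≤ f k ∧ f k ≤ 1)
    (hf : ∀ x : Fin (N + 1), x ≠ 0 → f x = holdingRate pt m x / (z + holdingRate pt m x) *
      ∑ y, jumpProb pt m x y * f y) :
    ∑' n, ∫⁻ ω in returnEvent Y T t n,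
        ENNReal.ofReal (Real.exp (-(z * ∑ k ∈ Finset.range n, (T (k + 1) ω : ℝ)))) ∂P =
      ENNReal.ofReal (f 1) * secondSojournProb (holdingRate pt m 0) t := by
  have hsum : ∀ x, ∑ y, ENNReal.ofReal (jumpProb pt m x y) * ENNReal.ofReal (f y) =
      ENNReal.ofReal (∑ y : Fin (N + 1), jumpProb pt m x y * f y) := by
    intro x
    have hfn : ∀ y : Fin (N + 1), 0 ≤ f y := fun y => (hfb y (by omega)).1
    rw [ENNReal.ofReal_sum_of_nonneg
      (fun y _ => mul_nonneg (jumpProb_nonneg hm x y) (hfn y))]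
    exact Finset.sum_congr rfl fun y _ => (ENNReal.ofReal_mul (jumpProb_nonneg hm x y)).symm
  simp_rw [setLIntegral_returnEvent h t hz]
  rw [ENNReal.tsum_mul_right]
  congr 1
  have ha := holdingRate_pos hN hpt hm
  rw [tsum_first_passage (r := fun x => ENNReal.ofReal
      (holdingRate pt m x / (z + holdingRate pt m x))) (f := fun x => ENNReal.ofReal (f x)) 0
      (jumpProb_nonneg hm) (sum_jumpProb hN hpt hm) (fun k x => rfl)]
  · rw [hsum, sum_jumpProb_mul_zero hN hpt hm f rfl, avoidWeight, one_mul]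
  · intro x
    rw [← ENNReal.ofReal_one]
    gcongr
    exact (hfb x (by omega)).2
  · simp [hf0]
  · intro x hx
    have := ha x
    rw [hsum, hf x hx, ENNReal.ofReal_mul (by positivity)]
  -- The weight at `0` is zero, so any `c` in `(0, 1)` dominates it. The decay comes from this
  -- killing and not from `z`, so `z = 0` is covered.
  · refine tendsto_sum_pathSum_jumpProb hN hpt hm hp (c := 1 / 2) (by norm_num) (by norm_num)
      (by simp [avoidWeight]) fun k x => ?_
    have := ha x
    simp only [avoidWeight]
    split_ifs
    · exact zero_le
    · rw [← ENNReal.ofReal_one]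
      gcongr
      exact (div_le_one (by positivity)).2 (by linarith)

end Excursion

end QuasiDiffusion

/-! ### Assembly: conditioning on a single excursion. -/

open QuasiDiffusion

theorem lemma5 {Ω : Type*} [MeasurableSpace Ω] (P : Measure Ω) [IsProbabilityMeasure P]
    (N : ℕ) (hN : 1 ≤ N) (pt m : Fin (N + 1) → ℝ) (hpt : StrictMono pt) (hm : ∀ i, 0 < m i)
    (hp : ∀ i j : Fin (N + 1), 0 < i.val → j.val = i.val + 1 →
      QuasiDiffusion.jumpProb pt m i j = 1 / 2)
    (a : ℕ → ℝ) (ha : ∀ i : Fin (N + 1), a i.val = QuasiDiffusion.holdingRate pt m i)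
    (X : ℝ≥0 → Ω → ℝ) (hX : QuasiDiffusion.IsQuasiDiffusion pt m 0 P X)
    (t : ℝ≥0) (ht : 0 < t) :
    (∀ᵐ ω ∂P, QuasiDiffusion.invLocalTime (fun s => X s ω) (pt 0) t < ∞) ∧
    ∀ z : ℝ, 0 ≤ z →
      QuasiDiffusion.laplaceTransform (QuasiDiffusion.excursionLaw P X (pt 0) (pt 1) t) z =
        QuasiDiffusion.minusFrac
          (fun k => if k = 1 then a 1 else a (k - 1) * a k)
          (fun k => if k = N then z + a N else 2 * (z + a k))
          1 N := by
  obtain ⟨Y, T, hY, hT, hbox, hpath⟩ := hX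
  have h : IsJumpHold P 0 (jumpProb pt m) (holdingRate pt m) Y T :=
    ⟨hY, hT, jumpProb_nonneg hm, sum_jumpProb hN hpt hm, holdingRate_pos hN hpt hm, hbox⟩
  have hstep : ∀ᵐ ω ∂P, IsStepPath (fun s => X s ω) (fun k => pt (Y k ω)) (fun k => T k ω) := by
    filter_upwards [hpath, h.ae_time_pos] with ω h1 h2 using ⟨h2, h1⟩
  have hlt := ae_exists_lt_timeAt hN hpt hm hp h t
  -- The numeral `1` is read modulo `N + 1`, so this needs `N ≥ 1`.
  have h1v : (1 : Fin (N + 1)).val = 1 := by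
    rw [Fin.val_one', Nat.mod_eq_of_lt (by omega)]
  have h01 : pt 0 ≠ pt 1 := fun h0 => by
    have := congrArg Fin.val (hpt.injective h0)
    rw [h1v] at this
    exact absurd this (by simp)
  have hone : ∀ᵐ ω ∂P, ∀ k, pt (Y k ω) = pt 0 → pt (Y (k + 1) ω) = pt 1 := by
    filter_upwards [h.ae_step] with ω hω k hk
    have hk0 : (Y k ω).val = 0 := congrArg Fin.val (hpt.injective hk)
    have hnb : (Y (k + 1) ω).val = (Y k ω).val + 1 ∨ (Y k ω).val = (Y (k + 1) ω).val + 1 := by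
      by_contra hc
      exact hω k (jumpProb_eq_zero hc)
    exact congrArg pt (Fin.ext (by omega))
  refine ⟨?_, fun z hz => ?_⟩
  · filter_upwards [hstep, hlt] with ω h1 h2
    obtain ⟨n, h3, h4⟩ := IsStepPath.exists_timeAt_le_lt h2
    rw [h1.invLocalTime_eq h3 h4]
    exact ENNReal.coe_lt_top
  set g : Ω → ℝ := fun ω => (invLocalTime (fun s => X s ω) (pt 0) t).toReal - (t : ℝ) with hg
  have hret : ∀ᵐ ω ∂P, ∀ n, ω ∈ returnEvent Y T t n →
      jumpCount (fun s => X s ω) (pt 0) (pt 1) t = 1 ∧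
        g ω = ∑ k ∈ Finset.range n, (T (k + 1) ω : ℝ) := by
    filter_upwards [hstep, hone, h.ae_start] with ω h1 h2 h3 n hn
    obtain ⟨h4, h5⟩ := h1.of_first_return h01 h2 (congrArg pt h3) (n := n + 1) (by omega)
      (fun k hk1 hkn hk => hn.1.1 (k - 1) (by omega)
        (by rw [Nat.sub_add_cancel hk1]; exact hpt.injective hk)) (congrArg pt hn.1.2)
      hn.2.1 hn.2.2
    refine ⟨h4, ?_⟩
    simp only [hg]
    rw [h5, Finset.sum_Ico_eq_sum_range, ENNReal.coe_toReal]
    push_cast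
    simp [add_comm]
  -- The jump-count event need not be measurable; it agrees a.e. with a measurable union, which
  -- suffices for restricting `P`.
  have hA : {ω | jumpCount (fun s => X s ω) (pt 0) (pt 1) t = 1} =ᵐ[P]
      ⋃ n, returnEvent Y T t n := by
    filter_upwards [hstep, hone, h.ae_start, hlt, hret] with ω h1 h2 h3 h4 h5
    refine propext ⟨fun hω => ?_, fun hω => ?_⟩
    · obtain ⟨n, hn1, hne, hn, hn2, hn3⟩ :=
        h1.exists_first_return h01 h2 (congrArg pt h3) h4 hω
      obtain ⟨n, rfl⟩ := Nat.exists_eq_succ_of_ne_zero (by omega : n ≠ 0)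
      exact Set.mem_iUnion.2 ⟨n, ⟨fun k hk h0 => hne (k + 1) (by omega) (by omega)
        (congrArg pt h0), hpt.injective hn⟩, hn2, hn3⟩
    · obtain ⟨n, hn⟩ := Set.mem_iUnion.1 hω
      exact (h5 n hn).1
  have hEm := measurableSet_returnEvent hY hT t
  have hEd := pairwise_disjoint_returnEvent Y T t
  set q := secondSojournProb (holdingRate pt m 0) t with hq
  have hq0 : q ≠ 0 := secondSojournProb_ne_zero (h.rate_pos 0) ht
  have hqt : q ≠ ∞ := secondSojournProb_ne_top (h.rate_pos 0) t
  have hPA : P {ω | jumpCount (fun s => X s ω) (pt 0) (pt 1) t = 1} = q := by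
    -- At `z = 0` with `f = 1`: the return is certain, so only the factor `q` is left.
    have := tsum_setLIntegral_returnEvent hN hpt hm hp h t le_rfl (f := fun _ => 1) rfl
      (fun _ _ => ⟨zero_le_one, le_rfl⟩) (fun x _ => by
        simp_rw [mul_one]
        rw [sum_jumpProb hN hpt hm, zero_add, div_self (h.rate_pos x).ne', one_mul])
    simp only [zero_mul, neg_zero, Real.exp_zero, ENNReal.ofReal_one, one_mul, lintegral_const,
      Measure.restrict_apply MeasurableSet.univ, Set.univ_inter] at this
    rw [measure_congr hA, measure_iUnion hEd hEm, this]
  have hgE : ∀ n, g =ᵐ[P.restrict (returnEvent Y T t n)]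
      fun ω => ∑ k ∈ Finset.range n, (T (k + 1) ω : ℝ) := fun n => by
    filter_upwards [ae_restrict_of_ae hret, ae_restrict_mem (hEm n)] with ω h1 h2
    exact (h1 n h2).2
  have hgm : AEMeasurable g (P.restrict (⋃ n, returnEvent Y T t n)) := by
    refine aemeasurable_iUnion_iff.2 fun n => AEMeasurable.congr ?_ (hgE n).symm
    exact (Finset.measurable_sum _ fun k _ => (hT (k + 1)).coe_nnreal_real).aemeasurable
  obtain ⟨f, hf0, hf1, hfb, hfi, hfN⟩ := exists_hitting_transform hN (a := a)
    (fun k hk => by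
      have := ha ⟨k, by omega⟩
      rw [show a k = _ from this]
      exact h.rate_pos _) hz
  have hint : ∫⁻ ω in ⋃ n, returnEvent Y T t n, ENNReal.ofReal (Real.exp (-(z * g ω))) ∂P =
      ENNReal.ofReal (f 1) * q := by
    rw [lintegral_iUnion hEm hEd, hq,
      ← tsum_setLIntegral_returnEvent hN hpt hm hp h t hz hf0 hfb]
    · congr 1
      ext n
      refine lintegral_congr_ae ?_
      filter_upwards [hgE n] with ω hω
      rw [hω]
    · intro x hx
      rw [← ha x]
      have hx0 : 0 < x.val := Nat.pos_of_ne_zero fun h0 => hx (Fin.ext h0)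
      by_cases hxN : x.val = N
      · rw [sum_jumpProb_mul_last hN hpt hm f hxN, hxN, hfN]
      · rw [sum_jumpProb_mul_interior hN hpt hm hp f hx0 (by omega), ← hfi x hx0 (by omega)]
  have hcond : ProbabilityTheory.cond P {ω | jumpCount (fun s => X s ω) (pt 0) (pt 1) t = 1} =
      q⁻¹ • P.restrict (⋃ n, returnEvent Y T t n) := by
    rw [ProbabilityTheory.cond, hPA, Measure.restrict_congr_set hA]
  have hexp : Measurable fun y : ℝ => Real.exp (-(z * y)) := by fun_prop
  have hgm' := hgm.smul_measure q⁻¹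
  -- The normalization `q⁻¹` cancels the factor `q` of the integral and leaves `f 1`.
  rw [← hf1, laplaceTransform, excursionLaw, hcond,
    integral_map hgm' hexp.aestronglyMeasurable,
    integral_eq_lintegral_of_nonneg_ae (Eventually.of_forall fun _ => (Real.exp_pos _).le)
      (hexp.comp_aemeasurable hgm').aestronglyMeasurable,
    lintegral_smul_measure, hint, smul_eq_mul, mul_comm, mul_assoc, ENNReal.mul_inv_cancel hq0 hqt,
    mul_one, ENNReal.toReal_ofReal (hfb 1 hN).1]
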